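/- Let $d\in\mathbb{N}$, $n\ge\max\{2,d\}$, and let $\xi_1,\dots,\xi_n$ be random vectors in $\mathbb{R}^d$, defined on a common probability space, such that for every permutation $\sigma\in\mathrm{Sym}(n)$ and all signs $\varepsilon_1,\dots,\varepsilon_n\in\{-1,+1\}$ with $\varepsilon_1\cdots\varepsilon_n=+1$, $$(\xi_1,\dots,\xi_n)\stackrel{d}{=}(\varepsilon_1\xi_{\sigma(1)},\dots,\varepsilon_n\xi_{\sigma(n)}).$$ Put $S_k=\xi_1+\dots+\xi_k$ for $1\le k\le n$, and $S_n^*=S_{n-1}-\xi_n$. Assume that any $d$ of the random vectors $S_1,\dots,S_n$ are linearly independent almost surely, and that any $d$ of the random vectors $S_1,\dots,S_{n-1},S_n^*$ are linearly independent almost surely. Then $$\mathbb{P}[0\in\mathrm{Conv}(S_1,\dots,S_{n-1},S_n,S_n^*)]=\frac{2}{2^{n-1}n!}\bigl(D(n,d+1)+D(n,d+3)+\dots\bigr),$$ where the numbers $D(n,k)$ are the coefficients of the polynomial $$(t+1)(t+3)\cdots(t+2n-3)\,(t+n-1)=\sum_{k=0}^n D(n,k)\,t^k,$$ $D(n,k)=0$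 for $k\notin\{0,\dots,n\}$, and $\mathrm{Conv}$ denotes the convex hull. -/

import Mathlib

open MeasureTheory ProbabilityTheory
open scoped Nat

noncomputable section

namespace DnWalk

variable {V : Type*} [AddCommGroup V]

/-- The partial sum `S_k = x_1 + ... + x_k` of a tuple `(x_1, ..., x_n)`; here `x_j` is the entry
of `x` with index `j - 1` in `Fin n`, and `k` is used in the range `1 ≤ k ≤ n`. -/
def partialSum {n : ℕ} (x : Fin n → V) (k : ℕ) : V :=
  ∑ i ∈ Finset.univ.filter (fun i : Fin n => (i : ℕ) < k), x i

/-- `S_n^* = S_{n-1} - x_n`. -/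
def starSum {n : ℕ} (hn : 0 < n) (x : Fin n → V) : V :=
  partialSum x (n - 1) - x ⟨n - 1, Nat.sub_lt hn Nat.one_pos⟩

/-- The collection `S_1, ..., S_{n-1}, S_n^*`, indexed by `1 ≤ k ≤ n`. -/
def starWalk {n : ℕ} (hn : 0 < n) (x : Fin n → V) (k : ℕ) : V :=
  if k = n then starSum hn x else partialSum x k

/-- The convex hull `Conv(S_1, ..., S_n, S_n^*)`. -/
def hull [Module ℝ V] {n : ℕ} (hn : 0 < n) (x : Fin n → V) : Set V :=
  convexHull ℝ (partialSum x '' Set.Icc 1 n ∪ {starSum hn x})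

/-- The polynomial `(t + 1)(t + 3)⋯(t + 2n - 3)(t + n - 1)`. -/
def polyD (n : ℕ) : Polynomial ℝ :=
  (∏ j ∈ Finset.range (n - 1), (Polynomial.X + Polynomial.C (2 * (j : ℝ) + 1))) *
    (Polynomial.X + Polynomial.C ((n : ℝ) - 1))

/-- The number `D(n, k)`, the coefficient of `t ^ k`; it is zero for `k > n`. -/
def coeffD (n k : ℕ) : ℝ :=
  (polyD n).coeff k

/-- The joint law of `(ξ_1, ..., ξ_n)` is invariant under all permutations of the entries combined
with an even number of sign changes. -/
def IsDnInvariant {Ω : Type*} [MeasurableSpace Ω] {n d : ℕ}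
    (ξ : Fin n → Ω → EuclideanSpace ℝ (Fin d)) (P : Measure Ω) : Prop :=
  ∀ (σ : Equiv.Perm (Fin n)) (ε : Fin n → ℝ), (∀ i, ε i = 1 ∨ ε i = -1) → ∏ i, ε i = 1 →
    IdentDistrib (fun ω i => ξ i ω) (fun ω i => ε i • ξ (σ i) ω) P P

/-- Any `d` of the random vectors `Y_1, ..., Y_n` in `ℝ^d` are linearly independent a.s. -/
def InGeneralPosition {Ω : Type*} [MeasurableSpace Ω] {d : ℕ} (n : ℕ)
    (Y : ℕ → Ω → EuclideanSpace ℝ (Fin d)) (P : Measure Ω) : Prop :=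
  ∀ I : Finset ℕ, I ⊆ Finset.Icc 1 n → I.card = d →
    ∀ᵐ ω ∂P, LinearIndependent ℝ (fun k : I => Y k ω)

end DnWalk

end

/-! Averaging over signed permutations turns the probability into a chamber count. Summation by
parts shows that 0 lies in the hull of a tuple exactly when some nonzero vector `γ` of coefficients
of a linear relation lies in the closed `D_n` chamber `γ_1 ≥ ... ≥ γ_{n-1} ≥ |γ_n|`. So the hull of
the tuple moved by `(σ, ε)` contains 0 iff the relation space of the original tuple meets the `D_n`
chamber indexed by `(σ, ε)` outside the origin (`zero_mem_hull_signedPerm_iff`).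

For a generic tuple the number of chambers met is a constant. For type `B`, inserting the last
coordinate gives a deletion-restriction recursion (`chamberCount_succ`). If `b(n, d)` is the count
for `n` generic vectors in dimension `d`, it reads `b(n+1, d+1) = b(n, d) + (2n+1) b(n, d+1)`, the
coefficient recursion of `(t+1)(t+3)⋯(t+2n-1)` (`chamberCount_eq`). A `D_n` chamber is two `B_n`
chambers glued along a `B_{n-1}` chamber, which gives `sum_meet_chamberD_eq`; the sum there counts
each `D_n` chamber twice.

All `2^n n!` events have the same probability: for an even number of sign changes by invariance, for
an odd number because negating the last step only swaps `S_n` and `S_n^*`. General position makes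
the tuple generic almost surely (`ae_generic`), so the expected count is that constant. -/

noncomputable section

namespace DnWalk

/-! ### Sums over signed permutations, split by one entry -/

/-- The permutation sending `p` to `j` and acting as `σ` on the remaining points. -/
def insertPerm {n : ℕ} (p j : Fin (n + 1)) (σ : Equiv.Perm (Fin n)) : Equiv.Perm (Fin (n + 1)) :=
  (finSuccEquiv' p).trans ((Equiv.optionCongr σ).trans (finSuccEquiv' j).symm)

@[simp] theorem insertPerm_self {n : ℕ} (p j : Fin (n + 1)) (σ : Equiv.Perm (Fin n)) :
    insertPerm p j σ p = j := by
  simp [insertPerm]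

@[simp] theorem insertPerm_succAbove {n : ℕ} (p j : Fin (n + 1)) (σ : Equiv.Perm (Fin n))
    (i : Fin n) : insertPerm p j σ (p.succAbove i) = j.succAbove (σ i) := by
  simp [insertPerm]

theorem insertPerm_injective {n : ℕ} (p j : Fin (n + 1)) :
    Function.Injective (insertPerm p j) := by
  intro σ τ h
  ext i : 1
  have := congrArg (fun f : Equiv.Perm (Fin (n + 1)) => f (p.succAbove i)) h
  simpa using this

theorem card_fin_prod_perm (n : ℕ) :
    Fintype.card (Fin (n + 1) × Equiv.Perm (Fin n)) =
      Fintype.card (Equiv.Perm (Fin (n + 1))) := by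
  simp [Fintype.card_perm, Nat.factorial_succ]

/-- Fixing the value and summing over its position suits the `B` recursion, where the last
coordinate is inserted everywhere. The companion `sum_perm_insert_value` fixes the position and
suits the cutting of `D` chambers. -/
theorem sum_perm_insert_position {n : ℕ} (j : Fin (n + 1))
    (F : Equiv.Perm (Fin (n + 1)) → ℝ) :
    ∑ σ, F σ = ∑ σ : Equiv.Perm (Fin n), ∑ p, F (insertPerm p j σ) := by
  rw [Finset.sum_comm, ← Fintype.sum_prod_type']
  refine (Function.Bijective.sum_comp (e := fun q : Fin (n + 1) × Equiv.Perm (Fin n) =>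
    insertPerm q.1 j q.2) ?_ F).symm
  refine (Fintype.bijective_iff_injective_and_card _).2 ⟨?_, card_fin_prod_perm n⟩
  rintro ⟨p, σ⟩ ⟨q, τ⟩ h
  have hp : p = q := by
    apply (insertPerm q j τ).injective
    simp only at h
    rw [insertPerm_self, ← h, insertPerm_self]
  subst hp
  exact congrArg _ (insertPerm_injective p j h)

theorem sum_perm_insert_value {n : ℕ} (p : Fin (n + 1))
    (F : Equiv.Perm (Fin (n + 1)) → ℝ) :
    ∑ σ, F σ = ∑ j, ∑ σ : Equiv.Perm (Fin n), F (insertPerm p j σ) := by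
  rw [← Fintype.sum_prod_type']
  refine (Function.Bijective.sum_comp (e := fun q : Fin (n + 1) × Equiv.Perm (Fin n) =>
    insertPerm p q.1 q.2) ?_ F).symm
  refine (Fintype.bijective_iff_injective_and_card _).2 ⟨?_, card_fin_prod_perm n⟩
  rintro ⟨i, σ⟩ ⟨j, τ⟩ h
  have hp : i = j := by
    have := congrArg (fun f : Equiv.Perm (Fin (n + 1)) => f p) h
    simpa using this
  subst hp
  exact congrArg _ (insertPerm_injective p i h)

theorem sum_signs_insert {n : ℕ} (p : Fin (n + 1)) (F : (Fin (n + 1) → ℤˣ) → ℝ) :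
    ∑ ε, F ε = ∑ ε : Fin n → ℤˣ, ∑ s : ℤˣ, F (Fin.insertNth p s ε) := by
  rw [Finset.sum_comm, ← Fintype.sum_prod_type']
  exact ((Fin.insertNthEquiv (fun _ => ℤˣ) p).sum_comp F).symm

/-- A sign as a real number. -/
def sg (u : ℤˣ) : ℝ := ((u : ℤ) : ℝ)

@[simp] theorem sg_one : sg 1 = 1 := by simp [sg]

@[simp] theorem sg_neg (u : ℤˣ) : sg (-u) = -sg u := by simp [sg]

theorem sg_mul (u v : ℤˣ) : sg (u * v) = sg u * sg v := by simp [sg]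

theorem sg_eq (u : ℤˣ) : sg u = 1 ∨ sg u = -1 := by
  rcases Int.units_eq_one_or u with rfl | rfl <;> simp

@[simp] theorem sg_mul_self (u : ℤˣ) : sg u * sg u = 1 := by
  rcases sg_eq u with h | h <;> simp [h]

@[simp] theorem sg_mul_sg_mul (u : ℤˣ) (a : ℝ) : sg u * (sg u * a) = a := by
  rw [← mul_assoc, sg_mul_self, one_mul]

theorem sg_ne_zero (u : ℤˣ) : sg u ≠ 0 := by
  rcases sg_eq u with h | h <;> simp [h]

theorem sum_sign (F : ℤˣ → ℝ) : ∑ s, F s = F 1 + F (-1) := by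
  rw [show (Finset.univ : Finset ℤˣ) = {1, -1} from rfl, Finset.sum_pair (by decide)]

/-! ### Cones cut by a hyperplane -/

/-- A set closed under addition and multiplication by positive scalars. -/
structure IsCone {E : Type*} [AddCommGroup E] [Module ℝ E] (C : Set E) : Prop where
  add_mem : ∀ u ∈ C, ∀ v ∈ C, u + v ∈ C
  smul_mem : ∀ c : ℝ, 0 < c → ∀ u ∈ C, c • u ∈ C

open Classical in
/-- The indicator of the event that the subspace `K` meets `C` outside the origin. -/
def meet {E : Type*} [AddCommGroup E] [Module ℝ E] (K : Submodule ℝ E) (C : Set E) : ℝ :=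
  if ∃ v ∈ K, v ≠ 0 ∧ v ∈ C then 1 else 0

theorem meet_congr {E F : Type*} [AddCommGroup E] [Module ℝ E] [AddCommGroup F] [Module ℝ F]
    {K : Submodule ℝ E} {C : Set E} {K' : Submodule ℝ F} {C' : Set F}
    (h : (∃ v ∈ K, v ≠ 0 ∧ v ∈ C) ↔ ∃ v ∈ K', v ≠ 0 ∧ v ∈ C') : meet K C = meet K' C' := by
  classical
  unfold meet
  exact if_congr h rfl rfl

/-- Inclusion-exclusion for a cone cut by a hyperplane. -/
theorem meet_split {E : Type*} [AddCommGroup E] [Module ℝ E] (K : Submodule ℝ E) {C : Set E}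
    (hC : IsCone C) (hs : ∀ u ∈ K, u ∈ C → -u ∈ C → u = 0) (f : E →ₗ[ℝ] ℝ) :
    meet K C + meet K (C ∩ {v | f v = 0}) =
      meet K (C ∩ {v | 0 ≤ f v}) + meet K (C ∩ {v | f v ≤ 0}) := by
  have h1 : (∃ v ∈ K, v ≠ 0 ∧ v ∈ C) ↔ (∃ v ∈ K, v ≠ 0 ∧ v ∈ C ∩ {v | 0 ≤ f v}) ∨
      (∃ v ∈ K, v ≠ 0 ∧ v ∈ C ∩ {v | f v ≤ 0}) := by
    constructor
    · rintro ⟨v, hv, h0, hc⟩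
      rcases le_total 0 (f v) with h | h
      · exact Or.inl ⟨v, hv, h0, hc, h⟩
      · exact Or.inr ⟨v, hv, h0, hc, h⟩
    · rintro (⟨v, hv, h0, hc, _⟩ | ⟨v, hv, h0, hc, _⟩) <;> exact ⟨v, hv, h0, hc⟩
  have h2 : (∃ v ∈ K, v ≠ 0 ∧ v ∈ C ∩ {v | f v = 0}) ↔
      (∃ v ∈ K, v ≠ 0 ∧ v ∈ C ∩ {v | 0 ≤ f v}) ∧
      (∃ v ∈ K, v ≠ 0 ∧ v ∈ C ∩ {v | f v ≤ 0}) := by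
    constructor
    · rintro ⟨v, hv, h0, hc, h⟩
      exact ⟨⟨v, hv, h0, hc, le_of_eq (Eq.symm h)⟩, ⟨v, hv, h0, hc, le_of_eq h⟩⟩
    · rintro ⟨⟨u, hu, hu0, huc, hfu⟩, ⟨v, hv, hv0, hvc, hfv⟩⟩
      simp only [Set.mem_ofPred_eq] at hfu hfv
      rcases eq_or_lt_of_le hfu with hfu | hfu
      · exact ⟨u, hu, hu0, huc, hfu.symm⟩
      rcases eq_or_lt_of_le hfv with hfv | hfv
      · exact ⟨v, hv, hv0, hvc, hfv⟩
      -- The segment from `u` to `v` crosses the hyperplane; this positive combination is the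
      -- crossing point up to scale. It is nonzero because otherwise `C` would contain two opposite
      -- nonzero vectors of `K`.
      have hA := hC.2 (-f v) (by linarith) u huc
      have hB := hC.2 (f u) hfu v hvc
      refine ⟨(-f v) • u + (f u) • v, K.add_mem (K.smul_mem _ hu) (K.smul_mem _ hv), ?_,
        hC.1 _ hA _ hB, ?_⟩
      · intro h
        have h3 := hs _ (K.smul_mem (-f v) hu) hA (by rwa [neg_eq_of_add_eq_zero_right h])
        rcases smul_eq_zero.1 h3 with h4 | h4
        · linarith
        · exact hu0 h4
      · simp only [Set.mem_ofPred_eq, map_add, map_smul, smul_eq_mul]; ring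
  classical
  unfold meet
  rw [if_congr h2 rfl rfl, if_congr h1 rfl rfl]
  generalize (∃ v ∈ K, v ≠ 0 ∧ v ∈ C ∩ {v | 0 ≤ f v}) = p
  generalize (∃ v ∈ K, v ≠ 0 ∧ v ∈ C ∩ {v | f v ≤ 0}) = q
  by_cases hp : p <;> by_cases hq : q <;> simp [hp, hq]

/-! ### Chambers of type `B` and relation spaces -/

/-- The closed Weyl chamber of type `B_n`. -/
def chamberB (n : ℕ) : Set (Fin n → ℝ) := {γ | Antitone γ ∧ ∀ i, 0 ≤ γ i}

/-- The action of a signed permutation on coordinates. -/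
def act {n : ℕ} (σ : Equiv.Perm (Fin n)) (ε : Fin n → ℤˣ) (β : Fin n → ℝ) : Fin n → ℝ :=
  fun i => sg (ε i) * β (σ i)

theorem act_insert {n : ℕ} (p j : Fin (n + 1)) (σ : Equiv.Perm (Fin n)) (s : ℤˣ)
    (ε : Fin n → ℤˣ) (β : Fin (n + 1) → ℝ) :
    act (insertPerm p j σ) (Fin.insertNth p s ε) β =
      Fin.insertNth p (sg s * β j) (act σ ε fun i => β (j.succAbove i)) := by
  rw [Fin.eq_insertNth_iff]
  constructor
  · simp [act]
  · ext i; simp [act, Fin.removeNth]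

theorem insertNth_mem_chamberB {n : ℕ} (p : Fin (n + 1)) (a : ℝ) (γ : Fin n → ℝ) :
    (Fin.insertNth p a γ : Fin (n + 1) → ℝ) ∈ chamberB (n + 1) ↔
      γ ∈ chamberB n ∧ 0 ≤ a ∧ (∀ i : Fin n, (i : ℕ) < p → a ≤ γ i) ∧
        ∀ i : Fin n, (p : ℕ) ≤ i → γ i ≤ a := by
  have hlt : ∀ i : Fin n, (i : ℕ) < p → p.succAbove i < p := fun i h => by
    rw [Fin.succAbove_of_castSucc_lt _ _ (by simpa [Fin.lt_def] using h)]
    simpa [Fin.lt_def] using h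
  have hle : ∀ i : Fin n, (p : ℕ) ≤ i → p < p.succAbove i := fun i h => by
    rw [Fin.succAbove_of_le_castSucc _ _ (by simpa [Fin.le_def] using h)]
    simp only [Fin.lt_def, Fin.val_succ]; omega
  constructor
  · rintro ⟨h1, h2⟩
    refine ⟨⟨fun i j hij => ?_, fun i => ?_⟩, ?_, fun i hi => ?_, fun i hi => ?_⟩
    · simpa using h1 ((Fin.strictMono_succAbove p).monotone hij)
    · simpa using h2 (p.succAbove i)
    · simpa using h2 p
    · simpa using h1 (hlt i hi).le
    · simpa using h1 (hle i hi).le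
  · rintro ⟨⟨h1, h2⟩, h3, h4, h5⟩
    refine ⟨fun i j => ?_, fun i => ?_⟩
    · induction i using Fin.succAboveCases p with
      | x =>
        induction j using Fin.succAboveCases p with
        | x => simp
        | p j =>
          intro hij
          simp only [Fin.insertNth_apply_same, Fin.insertNth_apply_succAbove]
          refine h5 j ?_
          by_contra h
          exact absurd (hlt j (not_le.1 h)) (not_lt.2 hij)
      | p i =>
        induction j using Fin.succAboveCases p with
        | x =>
          intro hij
          simp only [Fin.insertNth_apply_same, Fin.insertNth_apply_succAbove]
          refine h4 i ?_
          by_contra h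
          exact absurd (hle i (not_lt.1 h)) (not_lt.2 hij)
        | p j =>
          intro hij
          simp only [Fin.insertNth_apply_succAbove]
          exact h1 ((Fin.strictMono_succAbove p).le_iff_le.1 hij)
    · induction i using Fin.succAboveCases p with
      | x => simpa using h3
      | p i => simpa using h2 i

/-- The space of linear relations between the vectors `x_1, ..., x_n`. -/
def relations {V : Type*} [AddCommGroup V] [Module ℝ V] {n : ℕ} (x : Fin n → V) :
    Submodule ℝ (Fin n → ℝ) :=
  LinearMap.ker (Fintype.linearCombination ℝ x)

section

variable {V : Type*} [AddCommGroup V] [Module ℝ V] {n : ℕ}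

theorem mem_relations {x : Fin n → V} {β : Fin n → ℝ} :
    β ∈ relations x ↔ ∑ i, β i • x i = 0 := by
  simp [relations, Fintype.linearCombination_apply]

/-- The preimage of the `B_n` chamber under a signed permutation. -/
def chamber (σ : Equiv.Perm (Fin n)) (ε : Fin n → ℤˣ) : Set (Fin n → ℝ) :=
  {β | act σ ε β ∈ chamberB n}

/-- The number of chambers of type `B_n` met by the space of relations. -/
def chamberCount (x : Fin n → V) : ℝ :=
  ∑ σ : Equiv.Perm (Fin n), ∑ ε : Fin n → ℤˣ, meet (relations x) (chamber σ ε)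

/-- The nonzero absolute values of the entries of a vector. -/
def absValues (β : Fin n → ℝ) : Finset ℝ := (Finset.univ.image fun i => |β i|).erase 0

/-- Every nontrivial relation has more than `d` distinct nonzero absolute values. -/
def Generic (x : Fin n → V) (d : ℕ) : Prop :=
  ∀ β ∈ relations x, β ≠ 0 → d < (absValues β).card

theorem mem_absValues {β : Fin n → ℝ} {a : ℝ} : a ∈ absValues β ↔ a ≠ 0 ∧ ∃ i, |β i| = a := by
  simp [absValues]

theorem isCone_chamberB : IsCone (chamberB n) :=
  ⟨fun _ hu _ hv => ⟨hu.1.add hv.1, fun i => add_nonneg (hu.2 i) (hv.2 i)⟩,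
    fun _ hc _ hu => ⟨fun _ _ h => mul_le_mul_of_nonneg_left (hu.1 h) hc.le, fun i => mul_nonneg hc.le (hu.2 i)⟩⟩

theorem act_add (σ : Equiv.Perm (Fin n)) (ε : Fin n → ℤˣ) (u v : Fin n → ℝ) :
    act σ ε (u + v) = act σ ε u + act σ ε v := by
  ext i; simp [act, mul_add]

theorem act_smul (σ : Equiv.Perm (Fin n)) (ε : Fin n → ℤˣ) (c : ℝ) (v : Fin n → ℝ) :
    act σ ε (c • v) = c • act σ ε v := by
  ext i; simp [act, mul_left_comm]

theorem act_eq_zero {σ : Equiv.Perm (Fin n)} {ε : Fin n → ℤˣ} {v : Fin n → ℝ}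
    (h : act σ ε v = 0) : v = 0 := by
  ext i
  have := congrFun h (σ⁻¹ i)
  simpa [act, sg_ne_zero] using this

theorem isCone_act {C : Set (Fin n → ℝ)} (hC : IsCone C) (σ : Equiv.Perm (Fin n))
    (ε : Fin n → ℤˣ) : IsCone {β | act σ ε β ∈ C} :=
  ⟨fun u hu v hv => by
      simp only [Set.mem_ofPred_eq, act_add] at *; exact hC.1 _ hu _ hv,
    fun c hc u hu => by
      simp only [Set.mem_ofPred_eq, act_smul] at *; exact hC.2 _ hc _ hu⟩

/-! ### Deletion-restriction for type `B` chambers -/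

/-- The cylinder over a chamber of type `B_n`. -/
def cylinder (σ : Equiv.Perm (Fin n)) (ε : Fin n → ℤˣ) : Set (Fin (n + 1) → ℝ) :=
  {β | (fun i => β (Fin.castSucc i)) ∈ chamber σ ε}

theorem isCone_cylinder (σ : Equiv.Perm (Fin n)) (ε : Fin n → ℤˣ) : IsCone (cylinder σ ε) :=
  ⟨fun _ hu _ hv => (isCone_act isCone_chamberB σ ε).1 _ hu _ hv,
    fun c hc _ hu => (isCone_act isCone_chamberB σ ε).2 c hc _ hu⟩

/-- The cylinder contains the whole axis of the last coordinate. The relation space meets this axis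
only at 0, since the last vector is nonzero. -/
theorem cylinder_salient {x : Fin (n + 1) → V} (hx : x (Fin.last n) ≠ 0)
    (σ : Equiv.Perm (Fin n)) (ε : Fin n → ℤˣ) (u : Fin (n + 1) → ℝ) (hu : u ∈ relations x)
    (h1 : u ∈ cylinder σ ε) (h2 : -u ∈ cylinder σ ε) : u = 0 := by
  have h0 : (fun i => u (Fin.castSucc i)) = 0 := by
    refine act_eq_zero (σ := σ) (ε := ε) ?_
    ext i
    have a := h1.2 i
    have b := h2.2 i
    simp only [act, Pi.neg_apply, mul_neg] at a b
    simp only [act, Pi.zero_apply]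
    linarith
  have h3 : ∀ i : Fin n, u i.castSucc = 0 := fun i => congrFun h0 i
  rw [mem_relations, Fin.sum_univ_castSucc] at hu
  simp only [h3, zero_smul, Finset.sum_const_zero, zero_add, smul_eq_zero, hx, or_false] at hu
  ext i
  induction i using Fin.lastCases with
  | last => exact hu
  | cast i => exact h3 i

/-- The part of a cylinder on which the last coordinate, up to sign, is nonnegative and bounded by
the first `k` coordinates of the base point. -/
def slab (σ : Equiv.Perm (Fin n)) (ε : Fin n → ℤˣ) (s : ℤˣ) (k : ℕ) : Set (Fin (n + 1) → ℝ) :=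
  {β | β ∈ cylinder σ ε ∧ 0 ≤ sg s * β (Fin.last n) ∧
    ∀ i : Fin n, (i : ℕ) < k → sg s * β (Fin.last n) ≤ act σ ε (fun i => β i.castSucc) i}

theorem isCone_slab (σ : Equiv.Perm (Fin n)) (ε : Fin n → ℤˣ) (s : ℤˣ) (k : ℕ) :
    IsCone (slab σ ε s k) := by
  refine ⟨fun u hu v hv => ⟨(isCone_cylinder σ ε).1 _ hu.1 _ hv.1, ?_, fun i hi => ?_⟩,
    fun c hc u hu => ⟨(isCone_cylinder σ ε).2 c hc _ hu.1, ?_, fun i hi => ?_⟩⟩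
  · have := hu.2.1; have := hv.2.1; simp only [Pi.add_apply]; linarith
  · have := hu.2.2 i hi; have := hv.2.2 i hi; simp only [Pi.add_apply, act] at *; linarith
  · have := mul_nonneg hc.le hu.2.1; simp only [Pi.smul_apply, smul_eq_mul]; linarith
  · have := mul_le_mul_of_nonneg_left (hu.2.2 i hi) hc.le
    simp only [Pi.smul_apply, smul_eq_mul, act] at *; linarith

/-- The wall of a cylinder where the last coordinate equals, up to sign, that of the base point
at position `i`. -/
def wall (σ : Equiv.Perm (Fin n)) (ε : Fin n → ℤˣ) (s : ℤˣ) (i : Fin n) :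
    Set (Fin (n + 1) → ℝ) :=
  {β | β ∈ cylinder σ ε ∧ sg s * β (Fin.last n) = act σ ε (fun i => β i.castSucc) i}

/-- The hyperplane where the inserted entry equals the base entry at position `k` cuts the slab into
the chamber with insertion at `k` and the next slab. Monotonicity of the base entries supplies all
the other inequalities. -/
theorem meet_slab {x : Fin (n + 1) → V} (hx : x (Fin.last n) ≠ 0)
    (σ : Equiv.Perm (Fin n)) (ε : Fin n → ℤˣ) (s : ℤˣ) (k : Fin n) :
    meet (relations x) (slab σ ε s k) + meet (relations x) (wall σ ε s k) =
      meet (relations x)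
        (chamber (insertPerm k.castSucc (Fin.last n) σ) (Fin.insertNth k.castSucc s ε)) +
      meet (relations x) (slab σ ε s (k + 1)) := by
  let f : (Fin (n + 1) → ℝ) →ₗ[ℝ] ℝ :=
    sg s • LinearMap.proj (Fin.last n) - sg (ε k) • LinearMap.proj (σ k).castSucc
  have hf : ∀ β, f β = sg s * β (Fin.last n) - act σ ε (fun i => β i.castSucc) k := fun β => by
    simp [f, act]
  have h := meet_split (relations x) (isCone_slab σ ε s k)
    (fun u hu h1 h2 => cylinder_salient hx σ ε u hu h1.1 h2.1) f
  convert h using 3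
  · ext β
    simp only [wall, slab, Set.mem_inter_iff, Set.mem_ofPred_eq, hf, sub_eq_zero]
    constructor
    · rintro ⟨h1, h2⟩
      refine ⟨⟨h1, ?_, fun i hi => ?_⟩, h2⟩
      · rw [h2]; exact h1.2 k
      · rw [h2]; exact h1.1 (Fin.le_def.2 hi.le)
    · rintro ⟨⟨h1, -, -⟩, h2⟩
      exact ⟨h1, h2⟩
  · ext β
    simp only [chamber, slab, Set.mem_inter_iff, Set.mem_ofPred_eq, hf, act_insert,
      insertNth_mem_chamberB, Fin.succAbove_last, sub_nonneg, Fin.val_castSucc]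
    constructor
    · rintro ⟨h1, h2, h3, h4⟩
      exact ⟨⟨h1, h2, h3⟩, h4 k le_rfl⟩
    · rintro ⟨⟨h1, h2, h3⟩, h4⟩
      exact ⟨h1, h2, h3, fun i hi => (h1.1 (Fin.le_def.2 hi)).trans h4⟩
  · ext β
    simp only [slab, Set.mem_inter_iff, Set.mem_ofPred_eq, hf, sub_nonpos]
    constructor
    · rintro ⟨h1, h2, h3⟩
      exact ⟨⟨h1, h2, fun i hi => h3 i (hi.trans (Nat.lt_succ_self _))⟩,
        h3 k (Nat.lt_succ_self _)⟩
    · rintro ⟨⟨h1, h2, h3⟩, h4⟩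
      refine ⟨h1, h2, fun i hi => ?_⟩
      rcases Nat.lt_succ_iff_lt_or_eq.1 hi with hi | hi
      · exact h3 i hi
      · rw [Fin.ext hi]; exact h4

theorem slab_last (σ : Equiv.Perm (Fin n)) (ε : Fin n → ℤˣ) (s : ℤˣ) :
    slab σ ε s n =
      chamber (insertPerm (Fin.last n) (Fin.last n) σ) (Fin.insertNth (Fin.last n) s ε) := by
  ext β
  simp only [chamber, slab, Set.mem_ofPred_eq, act_insert, insertNth_mem_chamberB,
    Fin.succAbove_last, Fin.val_last]
  constructor
  · rintro ⟨h1, h2, h3⟩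
    exact ⟨h1, h2, h3, fun i hi => absurd i.2 (not_lt.2 hi)⟩
  · rintro ⟨h1, h2, h3, -⟩
    exact ⟨h1, h2, h3⟩

/-- `meet_slab` telescopes: the slabs cancel except for number 0, and slab number `n` is the chamber
with insertion at the end. -/
theorem sum_meet_slab {x : Fin (n + 1) → V} (hx : x (Fin.last n) ≠ 0)
    (σ : Equiv.Perm (Fin n)) (ε : Fin n → ℤˣ) (s : ℤˣ) :
    ∑ p, meet (relations x) (chamber (insertPerm p (Fin.last n) σ) (Fin.insertNth p s ε)) =
      meet (relations x) (slab σ ε s 0) + ∑ k, meet (relations x) (wall σ ε s k) := by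
  rw [Fin.sum_univ_castSucc, ← slab_last]
  have h : ∀ k : Fin n, meet (relations x)
        (chamber (insertPerm k.castSucc (Fin.last n) σ) (Fin.insertNth k.castSucc s ε)) =
      (fun k : ℕ => meet (relations x) (slab σ ε s k) - meet (relations x) (slab σ ε s (k + 1))) k
        + meet (relations x) (wall σ ε s k) := fun k => by
    have := meet_slab hx σ ε s k
    simp only
    linarith
  rw [Finset.sum_congr rfl fun k _ => h k, Finset.sum_add_distrib,
    Fin.sum_univ_eq_sum_range
      (fun k : ℕ => meet (relations x) (slab σ ε s k) - meet (relations x) (slab σ ε s (k + 1))) n,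
    Finset.sum_range_sub']
  ring

/-- The chambers of type `B_{n+1}` over a chamber of type `B_n`. -/
theorem sum_meet_fiber {x : Fin (n + 1) → V} (hx : x (Fin.last n) ≠ 0)
    (σ : Equiv.Perm (Fin n)) (ε : Fin n → ℤˣ) :
    ∑ p, ∑ s : ℤˣ,
      meet (relations x) (chamber (insertPerm p (Fin.last n) σ) (Fin.insertNth p s ε)) =
      meet (relations x) (cylinder σ ε) +
      meet (relations x) (cylinder σ ε ∩ {β | β (Fin.last n) = 0}) +
      ∑ s : ℤˣ, ∑ k, meet (relations x) (wall σ ε s k) := by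
  rw [Finset.sum_comm, Finset.sum_congr rfl fun s _ => sum_meet_slab hx σ ε s,
    Finset.sum_add_distrib]
  congr 1
  rw [sum_sign]
  -- The slabs with `k = 0` for the two signs are the halves of the cylinder on either side of the
  -- zero set of the last coordinate.
  have h := meet_split (relations x) (isCone_cylinder σ ε)
    (fun u hu h1 h2 => cylinder_salient hx σ ε u hu h1 h2) (LinearMap.proj (Fin.last n))
  simp only [LinearMap.proj_apply] at h
  rw [h]
  congr 2 <;> ext β <;> simp [slab]

/-- The cylinder leaves the last coordinate free, so only relations modulo the last vector matter;
each of these lifts. -/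
theorem meet_cylinder {x : Fin (n + 1) → V} (hx : x (Fin.last n) ≠ 0)
    (σ : Equiv.Perm (Fin n)) (ε : Fin n → ℤˣ) :
    meet (relations x) (cylinder σ ε) =
      meet (relations fun i : Fin n =>
        (Submodule.span ℝ {x (Fin.last n)}).mkQ (x i.castSucc)) (chamber σ ε) := by
  have key : ∀ β : Fin n → ℝ, β ∈ relations (fun i : Fin n =>
      (Submodule.span ℝ {x (Fin.last n)}).mkQ (x i.castSucc)) ↔
      ∑ i, β i • x i.castSucc ∈ Submodule.span ℝ {x (Fin.last n)} := fun β => by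
    conv_rhs => rw [← Submodule.ker_mkQ (Submodule.span ℝ {x (Fin.last n)})]
    rw [mem_relations, LinearMap.mem_ker, map_sum]
    simp only [map_smul]
  apply meet_congr
  constructor
  · rintro ⟨v, hv, hv0, hvc⟩
    rw [mem_relations, Fin.sum_univ_castSucc] at hv
    refine ⟨fun i => v i.castSucc, ?_, fun h => hv0 ?_, hvc⟩
    · rw [key, eq_neg_of_add_eq_zero_left hv]
      exact Submodule.neg_mem _ (Submodule.smul_mem _ _ (Submodule.mem_span_singleton_self _))
    · have h3 : ∀ i : Fin n, v i.castSucc = 0 := fun i => congrFun h i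
      simp only [h3, zero_smul, Finset.sum_const_zero, zero_add, smul_eq_zero, hx, or_false] at hv
      ext i
      induction i using Fin.lastCases with
      | last => exact hv
      | cast i => exact h3 i
  · rintro ⟨v, hv, hv0, hvc⟩
    rw [key, Submodule.mem_span_singleton] at hv
    obtain ⟨t, ht⟩ := hv
    refine ⟨Fin.snoc v (-t), ?_, fun h => hv0 ?_, ?_⟩
    · rw [mem_relations, Fin.sum_univ_castSucc]
      simp [← ht]
    · ext i
      have := congrFun h i.castSucc
      simpa using this
    · simpa [cylinder] using hvc

theorem meet_cylinder_inter (x : Fin (n + 1) → V) (σ : Equiv.Perm (Fin n)) (ε : Fin n → ℤˣ) :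
    meet (relations x) (cylinder σ ε ∩ {β | β (Fin.last n) = 0}) =
      meet (relations fun i : Fin n => x i.castSucc) (chamber σ ε) := by
  apply meet_congr
  constructor
  · rintro ⟨v, hv, hv0, hvc, hl⟩
    simp only [Set.mem_ofPred_eq] at hl
    rw [mem_relations, Fin.sum_univ_castSucc, hl, zero_smul, add_zero] at hv
    refine ⟨fun i => v i.castSucc, mem_relations.2 hv, fun h => hv0 ?_, hvc⟩
    ext i
    induction i using Fin.lastCases with
    | last => exact hl
    | cast i => exact congrFun h i
  · rintro ⟨v, hv, hv0, hvc⟩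
    refine ⟨Fin.snoc v 0, ?_, fun h => hv0 ?_, ?_, by simp⟩
    · rw [mem_relations] at *
      rw [Fin.sum_univ_castSucc]
      simpa using hv
    · ext i
      have := congrFun h i.castSucc
      simpa using this
    · simpa [cylinder] using hvc

/-- The tuple obtained by adding plus or minus the last vector to the vector at position `j`. -/
def merge (x : Fin (n + 1) → V) (s : ℤˣ) (j : Fin n) : Fin n → V :=
  fun i => x i.castSucc + if i = j then sg s • x (Fin.last n) else 0

theorem mem_relations_merge {x : Fin (n + 1) → V} {s : ℤˣ} {j : Fin n} {β : Fin n → ℝ} :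
    β ∈ relations (merge x s j) ↔
      (Fin.snoc β (sg s * β j) : Fin (n + 1) → ℝ) ∈ relations x := by
  simp only [mem_relations, Fin.sum_univ_castSucc, merge, smul_add, Finset.sum_add_distrib,
    smul_ite, smul_zero, Finset.sum_ite_eq', Finset.mem_univ, if_true, Fin.snoc_castSucc,
    Fin.snoc_last, smul_smul, mul_comm]

/-- On the wall the last coefficient is, up to sign, the coefficient at `σ k`, so the last vector
can be absorbed into the vector there. -/
theorem meet_wall (x : Fin (n + 1) → V) (σ : Equiv.Perm (Fin n)) (ε : Fin n → ℤˣ) (s : ℤˣ)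
    (k : Fin n) :
    meet (relations x) (wall σ ε s k) =
      meet (relations (merge x (s * ε k) (σ k))) (chamber σ ε) := by
  apply meet_congr
  constructor
  · rintro ⟨v, hv, hv0, hvc, hl⟩
    have hl' : v (Fin.last n) = sg (s * ε k) * v (σ k).castSucc := by
      rw [sg_mul, mul_assoc, ← sg_mul_sg_mul s (v (Fin.last n)), hl]; rfl
    refine ⟨fun i => v i.castSucc, ?_, fun h => hv0 ?_, hvc⟩
    · rw [mem_relations_merge]
      convert hv using 1
      ext i
      induction i using Fin.lastCases with
      | last => simp [hl']
      | cast i => simp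
    · ext i
      induction i using Fin.lastCases with
      | last => rw [hl', show v (σ k).castSucc = 0 from congrFun h (σ k), mul_zero]; rfl
      | cast i => exact congrFun h i
  · rintro ⟨v, hv, hv0, hvc⟩
    refine ⟨_, mem_relations_merge.1 hv, fun h => hv0 ?_, ?_, ?_⟩
    · ext i
      have := congrFun h i.castSucc
      simpa using this
    · simpa [cylinder] using hvc
    · simp [act, sg_mul, mul_assoc]

theorem sum_sum_comm {α β γ δ : Type*} [Fintype α] [Fintype β] [Fintype γ] [Fintype δ]
    (F : α → β → γ → δ → ℝ) :
    ∑ a, ∑ b, ∑ c, ∑ d, F a b c d = ∑ c, ∑ d, ∑ a, ∑ b, F a b c d := by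
  rw [← Fintype.sum_prod_type' fun a b => ∑ c, ∑ d, F a b c d,
    ← Fintype.sum_prod_type' fun c d => ∑ a, ∑ b, F a b c d]
  simp only [← Fintype.sum_prod_type' fun (c : γ) (d : δ) => F _ _ c d,
    ← Fintype.sum_prod_type' fun (a : α) (b : β) => F a b _ _]
  exact Finset.sum_comm

/-- The deletion-restriction recursion for the number of chambers. -/
theorem chamberCount_succ {x : Fin (n + 1) → V} (hx : x (Fin.last n) ≠ 0) :
    chamberCount x =
      chamberCount (fun i : Fin n => (Submodule.span ℝ {x (Fin.last n)}).mkQ (x i.castSucc)) +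
      chamberCount (fun i : Fin n => x i.castSucc) +
      ∑ s : ℤˣ, ∑ j, chamberCount (merge x s j) := by
  have h1 : chamberCount x = ∑ σ : Equiv.Perm (Fin n), ∑ ε : Fin n → ℤˣ, ∑ p, ∑ s : ℤˣ,
      meet (relations x) (chamber (insertPerm p (Fin.last n) σ) (Fin.insertNth p s ε)) := by
    rw [chamberCount, sum_perm_insert_position (Fin.last n)]
    refine Finset.sum_congr rfl fun σ _ => ?_
    refine (Finset.sum_congr rfl fun p _ => sum_signs_insert p _).trans Finset.sum_comm
  have h2 : ∑ s : ℤˣ, ∑ j, chamberCount (merge x s j) =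
      ∑ σ : Equiv.Perm (Fin n), ∑ ε : Fin n → ℤˣ, ∑ s : ℤˣ, ∑ j,
        meet (relations (merge x s j)) (chamber σ ε) := by
    simp only [chamberCount]
    exact sum_sum_comm fun s j σ ε => meet (relations (merge x s j)) (chamber σ ε)
  rw [h1, h2]
  simp only [chamberCount, ← Finset.sum_add_distrib]
  refine Finset.sum_congr rfl fun σ _ => Finset.sum_congr rfl fun ε _ => ?_
  rw [sum_meet_fiber hx, meet_cylinder hx, meet_cylinder_inter]
  congr 1
  simp only [meet_wall]
  rw [Finset.sum_comm]
  -- The walls carry index `σ k` and sign `s * ε k`; for fixed `σ` and `ε` these run bijectively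
  -- over all `j` and all signs.
  conv_rhs => rw [Finset.sum_comm, ← Equiv.sum_comp σ]
  exact Finset.sum_congr rfl fun k _ => Equiv.sum_comp (Equiv.mulRight (ε k))
    fun s => meet (relations (merge x s (σ k))) (chamber σ ε)

end

universe u

/-! ### Generic tuples and their stability under the recursion -/

section

variable {V : Type*} [AddCommGroup V] [Module ℝ V] {n : ℕ}

theorem Generic.ne_zero {x : Fin n → V} {d : ℕ} (h : Generic x (d + 1)) (i : Fin n) :
    x i ≠ 0 := by
  intro hi
  have h1 := h (Pi.single i 1) (by
    rw [mem_relations, Finset.sum_eq_single i] <;> simp +contextual [hi])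
    (by simp)
  have h2 : absValues (Pi.single i (1 : ℝ)) ⊆ {1} := by
    intro a ha
    obtain ⟨h0, j, rfl⟩ := mem_absValues.1 ha
    by_cases hj : j = i
    · subst hj; simp
    · simp [hj] at h0
  have := Finset.card_le_card h2
  simp only [Finset.card_singleton] at this
  omega

/-- Genericity passes to tuples whose relations extend without new absolute values. -/
theorem Generic.of_extend {W : Type*} [AddCommGroup W] [Module ℝ W] {m : ℕ} {x : Fin n → V}
    {y : Fin m → W} {d : ℕ} (h : Generic x d)
    (hext : ∀ β ∈ relations y, ∃ γ ∈ relations x, (γ = 0 → β = 0) ∧ absValues γ ⊆ absValues β) :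
    Generic y d := by
  intro β hβ h0
  obtain ⟨γ, hγ, h1, h2⟩ := hext β hβ
  exact (h γ hγ fun h => h0 (h1 h)).trans_le (Finset.card_le_card h2)

theorem Generic.succAbove {x : Fin (n + 1) → V} {d : ℕ} (h : Generic x d) (j : Fin (n + 1)) :
    Generic (fun i => x (j.succAbove i)) d := by
  refine h.of_extend fun β hβ => ⟨Fin.insertNth j 0 β, ?_, fun h => ?_, fun a ha => ?_⟩
  · rw [mem_relations] at *
    rw [Fin.sum_univ_succAbove _ j]
    simpa using hβ
  · ext i
    simpa using congrFun h (j.succAbove i)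
  · obtain ⟨h0, i, rfl⟩ := mem_absValues.1 ha
    induction i using Fin.succAboveCases j with
    | x => simp at h0
    | p i => exact mem_absValues.2 ⟨h0, i, by simp⟩

theorem Generic.merge {x : Fin (n + 1) → V} {d : ℕ} (h : Generic x d) (s : ℤˣ) (j : Fin n) :
    Generic (DnWalk.merge x s j) d := by
  refine h.of_extend fun β hβ => ⟨_, mem_relations_merge.1 hβ, fun h => ?_, fun a ha => ?_⟩
  · ext i
    simpa using congrFun h i.castSucc
  · obtain ⟨h0, i, rfl⟩ := mem_absValues.1 ha
    induction i using Fin.lastCases with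
    | last =>
      refine mem_absValues.2 ⟨h0, j, ?_⟩
      rcases sg_eq s with h | h <;> simp [h]
    | cast i => exact mem_absValues.2 ⟨h0, i, by simp⟩

/-- Lifting a relation modulo the last vector adds one coefficient, hence at most one absolute
value. This matches the loss of one dimension. -/
theorem Generic.quotient {x : Fin (n + 1) → V} {d : ℕ} (h : Generic x (d + 1)) :
    Generic (fun i : Fin n =>
      (Submodule.span ℝ {x (Fin.last n)}).mkQ (x i.castSucc)) d := by
  intro β hβ h0
  rw [mem_relations] at hβ
  have h1 : (Submodule.span ℝ {x (Fin.last n)}).mkQ (∑ i, β i • x i.castSucc) = 0 := by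
    rw [map_sum]; simpa only [map_smul] using hβ
  rw [← LinearMap.mem_ker, Submodule.ker_mkQ, Submodule.mem_span_singleton] at h1
  obtain ⟨t, ht⟩ := h1
  have h2 := h (Fin.snoc β (-t)) (by
    rw [mem_relations, Fin.sum_univ_castSucc]; simp [← ht])
    (fun h => h0 (by ext i; simpa using congrFun h i.castSucc))
  have h3 : absValues (Fin.snoc β (-t) : Fin (n + 1) → ℝ) ⊆ insert |t| (absValues β) := by
    intro a ha
    obtain ⟨h0, i, rfl⟩ := mem_absValues.1 ha
    rw [Finset.mem_insert]
    induction i using Fin.lastCases with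
    | last => left; simp
    | cast i => right; exact mem_absValues.2 ⟨h0, i, by simp⟩
  have := (Finset.card_le_card h3).trans (Finset.card_insert_le _ _)
  omega

/-! ### The number of type `B` chambers met -/

/-- The polynomial `(t + 1)(t + 3)⋯(t + 2n - 1)`. -/
def polyB (n : ℕ) : Polynomial ℝ :=
  ∏ j ∈ Finset.range n, (Polynomial.X + Polynomial.C (2 * (j : ℝ) + 1))

theorem polyB_succ (n : ℕ) :
    polyB (n + 1) = polyB n * (Polynomial.X + Polynomial.C (2 * (n : ℝ) + 1)) :=
  Finset.prod_range_succ _ _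

theorem coeff_polyB_succ (n k : ℕ) :
    (polyB (n + 1)).coeff (k + 1) =
      (polyB n).coeff k + (2 * (n : ℝ) + 1) * (polyB n).coeff (k + 1) := by
  rw [polyB_succ, mul_add, Polynomial.coeff_add, Polynomial.coeff_mul_X, Polynomial.coeff_mul_C,
    mul_comm]

theorem natDegree_polyB (n : ℕ) : (polyB n).natDegree ≤ n := by
  refine (Polynomial.natDegree_prod_le _ _).trans ?_
  exact (Finset.sum_le_card_nsmul _ _ 1 fun j _ => (Polynomial.natDegree_X_add_C _).le).trans
    (by simp)

theorem eval_one_polyB (n : ℕ) : (polyB n).eval 1 = 2 ^ n * (n ! : ℝ) := by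
  induction n with
  | zero => simp [polyB]
  | succ n ih =>
    rw [polyB_succ, Polynomial.eval_mul, ih, Nat.factorial_succ]
    simp only [Polynomial.eval_add, Polynomial.eval_X, Polynomial.eval_C]
    push_cast
    ring

theorem eval_neg_one_polyB (n : ℕ) : (polyB (n + 1)).eval (-1) = 0 := by
  rw [polyB, Finset.prod_range_succ', Polynomial.eval_mul]
  simp

theorem sum_odd (c : ℕ → ℝ) (m : ℕ) :
    ∑ i ∈ Finset.range (2 * m), c i * 1 ^ i - ∑ i ∈ Finset.range (2 * m), c i * (-1) ^ i =
      2 * ∑ j ∈ Finset.range m, c (1 + 2 * j) := by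
  induction m with
  | zero => simp
  | succ m ih =>
    rw [Nat.mul_succ, Finset.sum_range_succ, Finset.sum_range_succ, Finset.sum_range_succ,
      Finset.sum_range_succ, Finset.sum_range_succ, mul_add, ← ih, pow_succ (-1 : ℝ) (2 * m),
      pow_mul (-1 : ℝ)]
    simp only [one_pow, neg_one_sq, add_comm 1 (2 * m)]
    ring

/-- Twice the sum of the odd coefficients is the value at `1` minus the value at `-1`, and the
factor `t + 1` kills the latter. This is the base case of dimension 0. -/
theorem sum_odd_coeff_polyB {n m : ℕ} (h : n + 1 ≤ m) :
    2 * ∑ j ∈ Finset.range m, (polyB (n + 1)).coeff (1 + 2 * j) = 2 ^ (n + 1) * ((n + 1)! : ℝ) := by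
  have hd := natDegree_polyB (n + 1)
  rw [← sum_odd, ← Polynomial.eval_eq_sum_range' (by omega),
    ← Polynomial.eval_eq_sum_range' (by omega), eval_one_polyB, eval_neg_one_polyB, sub_zero]

/-- Every vector is a relation, so every chamber is met; the witness is the preimage of the all-ones
vector. -/
theorem chamberCount_subsingleton [Subsingleton V] (x : Fin (n + 1) → V) :
    chamberCount x = 2 ^ (n + 1) * ((n + 1)! : ℝ) := by
  have h : ∀ (σ : Equiv.Perm (Fin (n + 1))) (ε : Fin (n + 1) → ℤˣ),
      meet (relations x) (chamber σ ε) = 1 := by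
    intro σ ε
    refine if_pos ⟨fun i => sg (ε (σ⁻¹ i)), mem_relations.2 (Subsingleton.elim _ _),
      fun h => sg_ne_zero _ (congrFun h 0), ?_, ?_⟩
    · intro i j _; simp [act]
    · intro i; simp [act]
  simp only [chamberCount, h, Finset.sum_const, Finset.card_univ, Fintype.card_perm,
    Fintype.card_fin, Fintype.card_pi, Fintype.card_units_int, Finset.prod_const,
    nsmul_eq_mul, mul_one]
  push_cast
  ring

theorem finrank_quotient_span_singleton [FiniteDimensional ℝ V] {v : V} (hv : v ≠ 0) {d : ℕ}
    (h : Module.finrank ℝ V = d + 1) :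
    Module.finrank ℝ (V ⧸ Submodule.span ℝ {v}) = d := by
  have := Submodule.finrank_quotient_add_finrank (Submodule.span ℝ {v})
  rw [finrank_span_singleton hv] at this
  omega

end

/-- The number of chambers of type `B_n` met by the relations of a generic tuple. -/
theorem chamberCount_eq (m : ℕ) : ∀ (n d : ℕ), n ≤ m → ∀ (V : Type u) [AddCommGroup V]
    [Module ℝ V] [FiniteDimensional ℝ V] (x : Fin n → V), Module.finrank ℝ V = d →
    Generic x d →
    chamberCount x = 2 * ∑ j ∈ Finset.range m, (polyB n).coeff (d + 1 + 2 * j) := by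
  -- The length `m` of the sum stays fixed while `n ≤ m` varies, so all terms of the recursion are
  -- sums over the same range.
  intro n
  induction n with
  | zero =>
    intro d _ V _ _ _ x _ _
    have h1 : ∀ j, (polyB 0).coeff (d + 1 + 2 * j) = 0 := fun j => by
      simp [polyB, Polynomial.coeff_one]
    have h2 : ∀ (σ : Equiv.Perm (Fin 0)) (ε : Fin 0 → ℤˣ),
        meet (relations x) (chamber σ ε) = 0 := fun σ ε =>
      if_neg fun ⟨v, _, h, _⟩ => h (Subsingleton.elim _ _)
    simp [chamberCount, h1, h2]
  | succ n ih =>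
    intro d hm V _ _ _ x hV hx
    cases d with
    | zero =>
      have := Module.finrank_zero_iff.1 hV
      rw [chamberCount_subsingleton, ← sum_odd_coeff_polyB hm]
    | succ d =>
      have h0 := hx.ne_zero (Fin.last n)
      rw [chamberCount_succ h0,
        ih d (by omega) _ _ (finrank_quotient_span_singleton h0 hV) hx.quotient,
        ih (d + 1) (by omega) _ _ hV (by simpa using hx.succAbove (Fin.last n))]
      simp_rw [fun s j => ih (d + 1) (by omega) _ _ hV (hx.merge s j)]
      have h1 : ∀ j, (polyB (n + 1)).coeff (d + 1 + 1 + 2 * j) =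
          (polyB n).coeff (d + 1 + 2 * j) +
            (2 * (n : ℝ) + 1) * (polyB n).coeff (d + 1 + 1 + 2 * j) := fun j => by
        rw [show d + 1 + 1 + 2 * j = (d + 1 + 2 * j) + 1 by ring, coeff_polyB_succ]
      simp only [h1, Finset.sum_add_distrib, ← Finset.mul_sum, Finset.sum_const, Finset.card_univ,
        Fintype.card_fin, Fintype.card_units_int, nsmul_eq_mul]
      push_cast
      ring

/-! ### Negating the last step exchanges the two walks -/

section

variable {V : Type*} [AddCommGroup V] {m : ℕ}

/-- The tuple with the sign of its last vector changed. -/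
def flipLast (y : Fin (m + 1) → V) : Fin (m + 1) → V :=
  Function.update y (Fin.last m) (-y (Fin.last m))

theorem partialSum_flipLast (y : Fin (m + 1) → V) {k : ℕ} (hk : k ≤ m) :
    partialSum (flipLast y) k = partialSum y k := by
  refine Finset.sum_congr rfl fun i hi => ?_
  rw [flipLast, Function.update_of_ne]
  rintro rfl
  simp at hi
  omega

theorem partialSum_self {n : ℕ} (y : Fin n → V) : partialSum y n = ∑ i, y i := by
  simp [partialSum]

theorem partialSum_castSucc (y : Fin (m + 1) → V) :
    partialSum y m = ∑ i : Fin m, y i.castSucc := by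
  rw [partialSum, Finset.sum_filter, Fin.sum_univ_castSucc]
  simp

theorem starSum_eq (h : 0 < m + 1) (y : Fin (m + 1) → V) :
    starSum h y = ∑ i : Fin m, y i.castSucc - y (Fin.last m) := by
  rw [← partialSum_castSucc]; rfl

theorem partialSum_flipLast_self (h : 0 < m + 1) (y : Fin (m + 1) → V) :
    partialSum (flipLast y) (m + 1) = starSum h y := by
  rw [partialSum_self, starSum_eq, Fin.sum_univ_castSucc, sub_eq_add_neg]
  congr 1
  · refine Finset.sum_congr rfl fun i _ => ?_
    rw [flipLast, Function.update_of_ne (Fin.castSucc_lt_last i).ne]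
  · simp [flipLast]

theorem flipLast_flipLast (y : Fin (m + 1) → V) : flipLast (flipLast y) = y := by
  simp [flipLast]

theorem partialSum_self_eq_starSum_flipLast (h : 0 < m + 1) (y : Fin (m + 1) → V) :
    partialSum y (m + 1) = starSum h (flipLast y) := by
  rw [← partialSum_flipLast_self, flipLast_flipLast]

theorem starWalk_eq (h : 0 < m + 1) (y : Fin (m + 1) → V) {k : ℕ} (hk : k ≤ m + 1) :
    starWalk h y k = partialSum (flipLast y) k := by
  unfold starWalk
  split_ifs with h1
  · rw [h1, partialSum_flipLast_self h]
  · rw [partialSum_flipLast _ (by omega)]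

end

/-! ### Chambers of type `D` -/

section

variable {V : Type*} [AddCommGroup V] [Module ℝ V] {m : ℕ}

/-- The closed Weyl chamber of type `D_{m+1}`. -/
def chamberD (m : ℕ) : Set (Fin (m + 1) → ℝ) :=
  {γ | (fun i : Fin m => γ i.castSucc) ∈ chamberB m ∧
    ∀ i : Fin m, |γ (Fin.last m)| ≤ γ i.castSucc}

theorem isCone_chamberD : IsCone (chamberD m) := by
  refine ⟨fun u hu v hv => ⟨isCone_chamberB.1 _ hu.1 _ hv.1, fun i => ?_⟩,
    fun c hc u hu => ⟨isCone_chamberB.2 c hc _ hu.1, fun i => ?_⟩⟩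
  · exact (abs_add_le _ _).trans (add_le_add (hu.2 i) (hv.2 i))
  · simp only [Pi.smul_apply, smul_eq_mul, abs_mul, abs_of_pos hc]
    exact mul_le_mul_of_nonneg_left (hu.2 i) hc.le

theorem IsCone.convex {E : Type*} [AddCommGroup E] [Module ℝ E] {C : Set E} (hC : IsCone C) :
    Convex ℝ C :=
  convex_iff_forall_pos.2 fun _ hu _ hv _ _ ha hb _ =>
    hC.1 _ (hC.2 _ ha _ hu) _ (hC.2 _ hb _ hv)

/-- The first entry dominates all others in absolute value. For `m = 0` this fails, as the chamber
is the whole line. -/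
theorem eq_zero_of_mem_chamberD (hm : 1 ≤ m) {γ : Fin (m + 1) → ℝ} (h : γ ∈ chamberD m)
    (h0 : γ 0 ≤ 0) : γ = 0 := by
  obtain ⟨k, rfl⟩ : ∃ k, m = k + 1 := ⟨m - 1, by omega⟩
  have h1 : ∀ i : Fin (k + 1), γ i.castSucc = 0 := fun i =>
    le_antisymm ((h.1.1 (Fin.zero_le i)).trans h0) (h.1.2 i)
  ext i
  induction i using Fin.lastCases with
  | last =>
    have := h.2 0
    rw [h1] at this
    exact abs_nonpos_iff.1 this
  | cast i => exact h1 i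

theorem insertNth_mem_chamberD (a : ℝ) (γ : Fin m → ℝ) :
    (Fin.insertNth (Fin.last m) a γ : Fin (m + 1) → ℝ) ∈ chamberD m ↔
      γ ∈ chamberB m ∧ ∀ i, |a| ≤ γ i := by
  simp [chamberD]

theorem insertNth_last_mem_chamberB (a : ℝ) (γ : Fin m → ℝ) :
    (Fin.insertNth (Fin.last m) a γ : Fin (m + 1) → ℝ) ∈ chamberB (m + 1) ↔
      γ ∈ chamberB m ∧ 0 ≤ a ∧ ∀ i, a ≤ γ i := by
  rw [insertNth_mem_chamberB]
  simp only [Fin.val_last, Fin.is_lt, forall_const]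
  refine and_congr_right fun _ => and_congr_right fun _ => and_iff_left fun i hi => ?_
  exact absurd i.2 (not_lt.2 hi)

/-- A chamber of type `D` is cut into two chambers of type `B`. -/
theorem meet_chamberD (hm : 1 ≤ m) (x : Fin (m + 1) → V) (j : Fin (m + 1))
    (σ : Equiv.Perm (Fin m)) (s : ℤˣ) (ε : Fin m → ℤˣ) :
    meet (relations x) {β | act (insertPerm (Fin.last m) j σ)
        (Fin.insertNth (Fin.last m) s ε) β ∈ chamberD m} +
      meet (relations fun i => x (j.succAbove i)) (chamber σ ε) =
    meet (relations x)
      (chamber (insertPerm (Fin.last m) j σ) (Fin.insertNth (Fin.last m) s ε)) +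
    meet (relations x)
      (chamber (insertPerm (Fin.last m) j σ) (Fin.insertNth (Fin.last m) (-s) ε)) := by
  have h := meet_split (relations x) (isCone_act isCone_chamberD (insertPerm (Fin.last m) j σ)
    (Fin.insertNth (Fin.last m) s ε)) (fun u _ h1 h2 => by
      refine act_eq_zero (eq_zero_of_mem_chamberD hm h1 ?_)
      have h3 : (0 : Fin (m + 1)) = Fin.castSucc ⟨0, hm⟩ := rfl
      have := h2.1.2 ⟨0, hm⟩
      rw [h3]
      simp only [act, Pi.neg_apply, mul_neg] at this ⊢
      linarith) (sg s • LinearMap.proj j)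
  convert h using 2
  · apply meet_congr
    constructor
    · rintro ⟨v, hv, hv0, hvc⟩
      refine ⟨Fin.insertNth j 0 v, ?_, fun h => hv0 ?_, ?_, by simp⟩
      · rw [mem_relations] at *
        rw [Fin.sum_univ_succAbove _ j]
        simpa using hv
      · ext i
        simpa using congrFun h (j.succAbove i)
      · simp only [Set.mem_ofPred_eq, act_insert, insertNth_mem_chamberD]
        simp only [Fin.insertNth_apply_succAbove, Fin.insertNth_apply_same, mul_zero, abs_zero]
        exact ⟨hvc, hvc.2⟩
    · rintro ⟨v, hv, hv0, hvc, hl⟩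
      have hl : v j = 0 := by simpa [sg_ne_zero] using hl
      simp only [Set.mem_ofPred_eq, act_insert, insertNth_mem_chamberD] at hvc
      rw [mem_relations, Fin.sum_univ_succAbove _ j, hl, zero_smul, zero_add] at hv
      refine ⟨fun i => v (j.succAbove i), mem_relations.2 hv, fun h => hv0 ?_, hvc.1⟩
      ext i
      induction i using Fin.succAboveCases j with
      | x => exact hl
      | p i => exact congrFun h i
  · congr 1
    ext β
    simp only [chamber, Set.mem_inter_iff, Set.mem_ofPred_eq, act_insert, insertNth_mem_chamberD,
      insertNth_last_mem_chamberB, LinearMap.smul_apply, LinearMap.proj_apply, smul_eq_mul]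
    constructor
    · rintro ⟨h1, h2, h3⟩
      exact ⟨⟨h1, fun i => by rw [abs_of_nonneg h2]; exact h3 i⟩, h2⟩
    · rintro ⟨⟨h1, h2⟩, h3⟩
      exact ⟨h1, h3, fun i => (le_abs_self _).trans (h2 i)⟩
  · congr 1
    ext β
    simp only [chamber, Set.mem_inter_iff, Set.mem_ofPred_eq, act_insert, insertNth_mem_chamberD,
      insertNth_last_mem_chamberB, LinearMap.smul_apply, LinearMap.proj_apply, smul_eq_mul,
      sg_neg, neg_mul, Left.nonneg_neg_iff]
    constructor
    · rintro ⟨h1, h2, h3⟩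
      exact ⟨⟨h1, fun i => by rw [abs_of_nonpos h2]; exact h3 i⟩, h2⟩
    · rintro ⟨⟨h1, h2⟩, h3⟩
      exact ⟨h1, h3, fun i => (neg_le_abs _).trans (h2 i)⟩

theorem sum_meet_chamberD (hm : 1 ≤ m) (x : Fin (m + 1) → V) :
    ∑ σ : Equiv.Perm (Fin (m + 1)), ∑ ε : Fin (m + 1) → ℤˣ,
      meet (relations x) {β | act σ ε β ∈ chamberD m} =
    2 * chamberCount x - 2 * ∑ j, chamberCount (fun i => x (Fin.succAbove j i)) := by
  have hB : chamberCount x = ∑ j, ∑ σ : Equiv.Perm (Fin m), ∑ ε : Fin m → ℤˣ, ∑ s : ℤˣ,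
      meet (relations x)
        (chamber (insertPerm (Fin.last m) j σ) (Fin.insertNth (Fin.last m) s ε)) := by
    rw [chamberCount, sum_perm_insert_value (Fin.last m)]
    exact Finset.sum_congr rfl fun j _ => Finset.sum_congr rfl fun σ _ =>
      sum_signs_insert (Fin.last m) _
  rw [hB, sum_perm_insert_value (Fin.last m)]
  simp only [chamberCount, Finset.mul_sum, ← Finset.sum_sub_distrib]
  refine Finset.sum_congr rfl fun j _ => Finset.sum_congr rfl fun σ _ => ?_
  rw [sum_signs_insert (Fin.last m)]
  refine Finset.sum_congr rfl fun ε _ => ?_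
  -- Both choices of the sign of the last entry involve the same pair of `B` chambers, whence the
  -- factors 2.
  have h1 := meet_chamberD hm x j σ 1 ε
  have h2 := meet_chamberD hm x j σ (-1) ε
  rw [neg_neg] at h2
  simp only [sum_sign]
  linarith

/-- With `n = m + 1`, the last factor is `t + m = (t + 2m + 1) - (m + 1)`. The subtracted term
accounts for the `m + 1` possible deletions. -/
theorem coeffD_succ (m k : ℕ) :
    coeffD (m + 1) k = (polyB (m + 1)).coeff k - ((m : ℝ) + 1) * (polyB m).coeff k := by
  have h : polyD (m + 1) = polyB (m + 1) - Polynomial.C ((m : ℝ) + 1) * polyB m := by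
    rw [polyB_succ, polyD, Nat.add_sub_cancel]
    change polyB m * _ = _
    simp only [Nat.cast_add, Nat.cast_one, add_sub_cancel_right, Polynomial.C_add,
      Polynomial.C_mul, Polynomial.C_1]
    rw [show (Polynomial.C 2 : Polynomial ℝ) = 2 from rfl]
    ring
  rw [coeffD, h, Polynomial.coeff_sub, Polynomial.coeff_C_mul]

/-- The number of pairs of a signed permutation and a chamber of type `D` met by the relations. -/
theorem sum_meet_chamberD_eq [FiniteDimensional ℝ V] (hm : 1 ≤ m) (x : Fin (m + 1) → V)
    {M d : ℕ} (hM : m + 1 ≤ M) (hV : Module.finrank ℝ V = d) (hx : Generic x d) :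
    ∑ σ : Equiv.Perm (Fin (m + 1)), ∑ ε : Fin (m + 1) → ℤˣ,
      meet (relations x) {β | act σ ε β ∈ chamberD m} =
    4 * ∑ j ∈ Finset.range M, coeffD (m + 1) (d + 1 + 2 * j) := by
  rw [sum_meet_chamberD hm, chamberCount_eq M _ d hM V x hV hx]
  simp_rw [fun j => chamberCount_eq M _ d (Nat.le_of_succ_le hM) V _ hV (hx.succAbove j)]
  simp only [coeffD_succ, Finset.sum_sub_distrib, ← Finset.mul_sum, Finset.sum_const,
    Finset.card_univ, Fintype.card_fin, nsmul_eq_mul]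
  push_cast
  ring

/-! ### The hull contains 0 iff a relation lies in the `D` chamber -/

/-- Extension of a tuple by zeros. -/
def extendZero {n : ℕ} (γ : Fin n → ℝ) (k : ℕ) : ℝ := if h : k < n then γ ⟨k, h⟩ else 0

theorem extendZero_val {n : ℕ} (γ : Fin n → ℝ) (i : Fin n) : extendZero γ i = γ i := by
  simp [extendZero]

theorem extendZero_self {n : ℕ} (γ : Fin n → ℝ) : extendZero γ n = 0 := by
  simp [extendZero]

theorem antitone_extendZero {n : ℕ} {γ : Fin n → ℝ} (h : γ ∈ chamberB n) :
    Antitone (extendZero γ) := by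
  intro a b hab
  unfold extendZero
  split_ifs with h1 h2
  · exact h.1 (Fin.le_def.2 hab)
  · omega
  · exact h.2 _
  · exact le_rfl

/-- Summation by parts. -/
theorem sum_smul_eq_sum_partialSum {n : ℕ} (γ : Fin n → ℝ) (y : Fin n → V) :
    ∑ i, γ i • y i =
      ∑ k ∈ Finset.range n, (extendZero γ k - extendZero γ (k + 1)) • partialSum y (k + 1) := by
  simp only [partialSum, Finset.sum_filter, Finset.smul_sum, smul_ite, smul_zero]
  rw [Finset.sum_comm]
  refine Finset.sum_congr rfl fun i _ => ?_
  rw [← Finset.sum_filter, ← Finset.sum_smul]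
  congr 1
  have h : (Finset.range n).filter (fun k => (i : ℕ) < k + 1) = Finset.Ico (i : ℕ) n := by
    ext k; simp only [Finset.mem_filter, Finset.mem_range, Finset.mem_Ico]; omega
  rw [h, Finset.sum_Ico_eq_sub _ i.2.le, Finset.sum_range_sub', Finset.sum_range_sub',
    extendZero_self, extendZero_val]
  ring

/-- After summation by parts the weights are the descents of `γ`: nonnegative by monotonicity, with
telescoping sum `γ 0 = 1`. -/
theorem sum_smul_mem_convexHull {y : Fin (m + 1) → V} {γ : Fin (m + 1) → ℝ}
    (h : γ ∈ chamberB (m + 1)) (h0 : γ 0 = 1) :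
    ∑ i, γ i • y i ∈ convexHull ℝ (partialSum y '' Set.Icc 1 (m + 1)) := by
  rw [sum_smul_eq_sum_partialSum]
  refine (convex_convexHull ℝ _).sum_mem (fun k _ => ?_) ?_ (fun k hk => ?_)
  · exact sub_nonneg.2 (antitone_extendZero h (Nat.le_succ k))
  · rw [Finset.sum_range_sub', extendZero_self, sub_zero, ← h0]
    exact extendZero_val γ 0
  · exact subset_convexHull ℝ _ ⟨k + 1, ⟨by omega, by simpa using hk⟩, rfl⟩

theorem convexHull_flipLast_subset (h : 0 < m + 1) (y : Fin (m + 1) → V) :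
    convexHull ℝ (partialSum (flipLast y) '' Set.Icc 1 (m + 1)) ⊆ hull h y := by
  refine convexHull_mono ?_
  rintro _ ⟨k, ⟨h1, h2⟩, rfl⟩
  rcases Nat.lt_or_eq_of_le h2 with h2 | rfl
  · rw [partialSum_flipLast y (by omega)]
    exact Or.inl ⟨k, ⟨h1, h2.le⟩, rfl⟩
  · rw [partialSum_flipLast_self h]
    exact Or.inr rfl

theorem hull_flipLast (h : 0 < m + 1) (y : Fin (m + 1) → V) :
    hull h (flipLast y) = hull h y := by
  have key : ∀ z : Fin (m + 1) → V, hull h (flipLast z) ⊆ hull h z := fun z => by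
    refine convexHull_min ?_ (convex_convexHull ℝ _)
    rintro v (hv | hv)
    · exact convexHull_flipLast_subset h z (subset_convexHull ℝ _ hv)
    · rw [Set.mem_singleton_iff.1 hv, ← partialSum_self_eq_starSum_flipLast]
      exact subset_convexHull ℝ _ (Or.inl ⟨m + 1, ⟨by omega, le_rfl⟩, rfl⟩)
  refine (key y).antisymm ?_
  simpa only [flipLast_flipLast] using key (flipLast y)

theorem zero_mem_hull_iff (hm : 1 ≤ m) (h : 0 < m + 1) (y : Fin (m + 1) → V) :
    (0 : V) ∈ hull h y ↔ ∃ γ ∈ chamberD m, γ 0 = 1 ∧ ∑ i, γ i • y i = 0 := by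
  constructor
  · intro h0
    -- The slice `γ 0 = 1` of the chamber is convex and contains the coefficient vectors of all
    -- generators: ones followed by zeros for `S_k`, and ones followed by `-1` for `S_n^*`.
    have hsub : hull h y ⊆ Fintype.linearCombination ℝ y ''
        (chamberD m ∩ {γ | (LinearMap.proj 0 : (Fin (m + 1) → ℝ) →ₗ[ℝ] ℝ) γ = 1}) := by
      refine convexHull_min ?_ (Convex.linear_image (isCone_chamberD.convex.inter ?_) _)
      · rintro _ (⟨k, ⟨h1, h2⟩, rfl⟩ | hv)
        · refine ⟨fun i => if (i : ℕ) < k then 1 else 0, ⟨⟨⟨fun i j hij => ?_, fun i => ?_⟩,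
            fun i => ?_⟩, ?_⟩, ?_⟩
          · have : (i : ℕ) ≤ j := hij
            simp only [Fin.val_castSucc]
            split_ifs <;> first | omega | norm_num
          · simp only; split_ifs <;> norm_num
          · have := i.2
            simp only [Fin.val_castSucc, Fin.val_last]
            split_ifs <;> first | omega | norm_num
          · exact if_pos (show ((0 : Fin (m + 1)) : ℕ) < k by rw [Fin.val_zero]; omega)
          · rw [Fintype.linearCombination_apply, partialSum, Finset.sum_filter]
            simp
        · rw [Set.mem_singleton_iff.1 hv]
          refine ⟨Fin.snoc (fun _ => 1) (-1), ⟨⟨⟨fun i j hij => ?_, fun i => ?_⟩,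
            fun i => ?_⟩, ?_⟩, ?_⟩
          · simp
          · simp
          · simp
          · have h3 : (0 : Fin (m + 1)) = Fin.castSucc ⟨0, hm⟩ := rfl
            simp only [Set.mem_ofPred_eq, LinearMap.proj_apply]
            rw [h3, Fin.snoc_castSucc]
          · rw [Fintype.linearCombination_apply, Fin.sum_univ_castSucc, starSum_eq]
            simp [sub_eq_add_neg]
      · exact convex_hyperplane (LinearMap.isLinear _) 1
    obtain ⟨γ, ⟨h1, h2⟩, h3⟩ := hsub h0
    exact ⟨γ, h1, h2, by simpa [Fintype.linearCombination_apply] using h3⟩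
  -- If the last entry of `γ` is nonnegative, `γ` lies in the `B` chamber and the walk without
  -- `S_n^*` suffices. Otherwise the last entry and the last step are negated together.
  · rintro ⟨γ, hγ, h1, h2⟩
    have key : ∀ z : Fin (m + 1) → V, ∀ γ ∈ chamberD m, γ 0 = 1 → 0 ≤ γ (Fin.last m) →
        ∑ i, γ i • z i ∈ convexHull ℝ (partialSum z '' Set.Icc 1 (m + 1)) := by
      intro z γ hγ h1 h3
      refine sum_smul_mem_convexHull ?_ h1
      have := (insertNth_last_mem_chamberB (γ (Fin.last m)) (fun i : Fin m => γ i.castSucc)).2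
        ⟨hγ.1, h3, fun i => (le_abs_self _).trans (hγ.2 i)⟩
      convert this
      rw [Fin.eq_insertNth_iff]
      exact ⟨rfl, by ext i; simp [Fin.removeNth]⟩
    rcases le_total 0 (γ (Fin.last m)) with h3 | h3
    · rw [← h2]
      exact convexHull_mono Set.subset_union_left (key y γ hγ h1 h3)
    · refine convexHull_flipLast_subset h y ?_
      have hc : ∀ i : Fin m, (flipLast γ) i.castSucc = γ i.castSucc := fun i => by
        rw [flipLast, Function.update_of_ne (Fin.castSucc_lt_last i).ne]
      have hl : flipLast γ (Fin.last m) = -γ (Fin.last m) := by simp [flipLast]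
      have h4 := key (flipLast y) (flipLast γ) ⟨by simpa only [hc] using hγ.1, fun i => by
        rw [hl, hc, abs_neg]; exact hγ.2 i⟩ (by
          rw [← h1]; exact hc ⟨0, hm⟩) (by rw [hl]; linarith)
      convert h4
      rw [← h2]
      refine Finset.sum_congr rfl fun i _ => ?_
      by_cases hi : i = Fin.last m
      · subst hi; simp [flipLast]
      · simp [flipLast, Function.update_of_ne hi]

/-- The tuple transformed by a signed permutation. -/
def signedPerm {n : ℕ} (σ : Equiv.Perm (Fin n)) (ε : Fin n → ℤˣ) (x : Fin n → V) : Fin n → V :=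
  fun i => sg (ε i) • x (σ i)

theorem sum_act_smul_signedPerm {n : ℕ} (σ : Equiv.Perm (Fin n)) (ε : Fin n → ℤˣ)
    (x : Fin n → V) (β : Fin n → ℝ) :
    ∑ i, act σ ε β i • signedPerm σ ε x i = ∑ i, β i • x i := by
  rw [← Equiv.sum_comp σ fun i => β i • x i]
  refine Finset.sum_congr rfl fun i _ => ?_
  rw [act, signedPerm, smul_smul, mul_right_comm, sg_mul_self, one_mul]

theorem act_surjective {n : ℕ} (σ : Equiv.Perm (Fin n)) (ε : Fin n → ℤˣ) (γ : Fin n → ℝ) :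
    act σ ε (fun i => sg (ε (σ⁻¹ i)) * γ (σ⁻¹ i)) = γ := by
  ext i; simp [act]

theorem zero_mem_hull_signedPerm_iff (hm : 1 ≤ m) (h : 0 < m + 1)
    (σ : Equiv.Perm (Fin (m + 1))) (ε : Fin (m + 1) → ℤˣ) (x : Fin (m + 1) → V) :
    (0 : V) ∈ hull h (signedPerm σ ε x) ↔
      ∃ β ∈ relations x, β ≠ 0 ∧ β ∈ {β | act σ ε β ∈ chamberD m} := by
  rw [zero_mem_hull_iff hm]
  constructor
  · rintro ⟨γ, hγ, h1, h2⟩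
    refine ⟨fun i => sg (ε (σ⁻¹ i)) * γ (σ⁻¹ i), ?_, fun h => ?_, ?_⟩
    · rw [mem_relations, ← sum_act_smul_signedPerm σ ε, act_surjective, h2]
    · have := congrFun (act_surjective σ ε γ) 0
      rw [h, h1] at this
      simp [act] at this
    · rw [Set.mem_ofPred_eq, act_surjective]; exact hγ
  · rintro ⟨β, hβ, h0, hc⟩
    have hpos : 0 < act σ ε β 0 := by
      by_contra hneg
      exact h0 (act_eq_zero (eq_zero_of_mem_chamberD hm hc (not_lt.1 hneg)))
    refine ⟨(act σ ε β 0)⁻¹ • act σ ε β, isCone_chamberD.2 _ (inv_pos.2 hpos) _ hc,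
      inv_mul_cancel₀ hpos.ne', ?_⟩
    simp only [Pi.smul_apply, smul_assoc]
    rw [← Finset.smul_sum, sum_act_smul_signedPerm, mem_relations.1 hβ, smul_zero]

end

/-! ### Genericity from linear independence of partial sums -/

section

variable {V : Type*} [AddCommGroup V] [Module ℝ V]

/-- The signs make all entries nonnegative, and sorting by `-|β i|` makes them decrease. -/
theorem exists_act_mem_chamberB {n : ℕ} (β : Fin n → ℝ) :
    ∃ σ ε, act σ ε β ∈ chamberB n := by
  have hs : ∀ a : ℝ, ∃ s : ℤˣ, sg s * a = |a| := fun a => by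
    rcases abs_choice a with h | h
    · exact ⟨1, by simp [h]⟩
    · exact ⟨-1, by simp [h]⟩
  choose s hs using hs
  have h : ∀ i, act (Tuple.sort fun i => -|β i|)
      (fun i => s (β (Tuple.sort (fun i => -|β i|) i))) β i =
      |β (Tuple.sort (fun i => -|β i|) i)| := fun i => hs _
  refine ⟨Tuple.sort fun i => -|β i|, fun i => s (β (Tuple.sort (fun i => -|β i|) i)),
    fun i j hij => ?_, fun i => ?_⟩
  · rw [h, h]
    exact neg_le_neg_iff.1 (Tuple.monotone_sort (fun i => -|β i|) hij)
  · rw [h]; exact abs_nonneg _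

/-- The positions at which an antitone nonnegative tuple descends are at most as many as its
absolute values. -/
theorem card_descents_le {n : ℕ} {σ : Equiv.Perm (Fin n)} {ε : Fin n → ℤˣ} {β : Fin n → ℝ}
    (h : act σ ε β ∈ chamberB n) :
    ((Finset.range n).filter fun k =>
      extendZero (act σ ε β) k ≠ extendZero (act σ ε β) (k + 1)).card ≤ (absValues β).card := by
  have hanti := antitone_extendZero h
  have hlt : ∀ k, extendZero (act σ ε β) k ≠ extendZero (act σ ε β) (k + 1) →
      extendZero (act σ ε β) (k + 1) < extendZero (act σ ε β) k := fun k hk =>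
    lt_of_le_of_ne (hanti (Nat.le_succ k)) (Ne.symm hk)
  have hnn : ∀ k, 0 ≤ extendZero (act σ ε β) k := fun k => by
    unfold extendZero
    split_ifs
    · exact h.2 _
    · exact le_rfl
  refine Finset.card_le_card_of_injOn (extendZero (act σ ε β)) (fun k hk => ?_) ?_
  · obtain ⟨hk, hne⟩ := Finset.mem_filter.1 hk
    rw [Finset.mem_range] at hk
    have hpos := (hnn (k + 1)).trans_lt (hlt k hne)
    refine mem_absValues.2 ⟨hpos.ne', σ ⟨k, hk⟩, ?_⟩
    rw [← abs_of_pos hpos, extendZero, dif_pos hk, act, abs_mul]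
    rcases sg_eq (ε ⟨k, hk⟩) with h | h <;> simp [h]
  · have key : ∀ k l, extendZero (act σ ε β) k ≠ extendZero (act σ ε β) (k + 1) → k < l →
        extendZero (act σ ε β) k ≠ extendZero (act σ ε β) l := fun k l hk hkl =>
      ((hanti hkl).trans_lt (hlt k hk)).ne'
    intro k hk l hl hkl
    have hk := (Finset.mem_filter.1 hk).2
    have hl := (Finset.mem_filter.1 hl).2
    by_contra hne
    rcases lt_or_gt_of_ne hne with h | h
    · exact key k l hk h hkl
    · exact key l k hl h hkl.symm

/-- A tuple is generic if any `d` partial sums of each of its signed permutations are linearly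
independent. -/
theorem generic_of_linearIndependent {n d : ℕ} (hd : d ≤ n) {x : Fin n → V}
    (h : ∀ σ ε, ∀ I : Finset ℕ, I ⊆ Finset.Icc 1 n → I.card = d →
      LinearIndependent ℝ (fun k : I => partialSum (signedPerm σ ε x) k)) :
    Generic x d := by
  intro β hβ h0
  by_contra hcard
  rw [not_lt] at hcard
  obtain ⟨σ, ε, hB⟩ := exists_act_mem_chamberB β
  have hc := (card_descents_le hB).trans hcard
  rw [mem_relations, ← sum_act_smul_signedPerm σ ε, sum_smul_eq_sum_partialSum] at hβ
  set g := extendZero (act σ ε β) with hg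
  set y := signedPerm σ ε x
  set D := (Finset.range n).filter fun k => g k ≠ g (k + 1) with hD
  -- The drop from index `k` to `k + 1` is the coefficient of the partial sum `k + 1`, hence the
  -- shift. The at most `d` descents are padded to exactly `d` indices, as the hypothesis requires.
  obtain ⟨I, hDI, hI, hIc⟩ := Finset.exists_subsuperset_card_eq
    (s := D.image (· + 1)) (t := Finset.Icc 1 n) (n := d)
    (fun k hk => by
      obtain ⟨j, hj, rfl⟩ := Finset.mem_image.1 hk
      have := (Finset.mem_filter.1 hj).1
      rw [Finset.mem_range] at this
      rw [Finset.mem_Icc]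
      omega)
    (Finset.card_image_le.trans hc) (by simpa using hd)
  have hLI : LinearIndepOn ℝ (fun k => partialSum y k) (I : Set ℕ) := h σ ε I hI hIc
  have hz : ∀ k ∈ Finset.Icc 1 n, k ∉ I → g (k - 1) - g k = 0 := fun k hk hkI => by
    by_contra hne
    rw [Finset.mem_Icc] at hk
    refine hkI (hDI (Finset.mem_image.2 ⟨k - 1, Finset.mem_filter.2 ⟨?_, ?_⟩, ?_⟩))
    · rw [Finset.mem_range]; omega
    · rw [Nat.sub_add_cancel hk.1]; exact fun h => hne (sub_eq_zero.2 h)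
    · exact Nat.sub_add_cancel hk.1
  have hsum : ∑ k ∈ I, (g (k - 1) - g k) • partialSum y k = 0 := by
    rw [Finset.sum_subset hI fun k hk hkI => by rw [hz k hk hkI, zero_smul], ← hβ]
    have himage : Finset.Icc 1 n = (Finset.range n).image (· + 1) := by
      ext k
      simp only [Finset.mem_Icc, Finset.mem_image, Finset.mem_range]
      exact ⟨fun h => ⟨k - 1, by omega, by omega⟩, by rintro ⟨j, hj, rfl⟩; omega⟩
    rw [himage, Finset.sum_image (by simp)]
    simp only [Nat.add_sub_cancel]
  have hI0 := linearIndepOn_finset_iff.1 hLI _ hsum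
  have hstep : ∀ k < n, g k = g (k + 1) := fun k hk => by
    have hk' : k + 1 ∈ Finset.Icc 1 n := by rw [Finset.mem_Icc]; omega
    by_cases hkI : k + 1 ∈ I
    · simpa [sub_eq_zero] using hI0 _ hkI
    · simpa [sub_eq_zero] using hz _ hk' hkI
  have hzero : ∀ t ≤ n, g (n - t) = 0 := by
    intro t
    induction t with
    | zero => intro _; exact extendZero_self _
    | succ t ih =>
      intro ht
      rw [hstep _ (by omega), show n - (t + 1) + 1 = n - t by omega]
      exact ih (by omega)
  refine h0 (act_eq_zero (σ := σ) (ε := ε) ?_)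
  ext i
  have := hzero (n - i) (by omega)
  rw [show n - (n - (i : ℕ)) = i by omega, hg, extendZero_val] at this
  exact this

end

/-! ### Measurability and the averaging argument -/

section

variable {m d : ℕ}

theorem isCompact_chamberD_inter :
    IsCompact (chamberD m ∩ {γ : Fin (m + 1) → ℝ | γ 0 = 1}) := by
  refine (isCompact_Icc (a := fun _ => (-1 : ℝ)) (b := fun _ => (1 : ℝ))).of_isClosed_subset ?_ ?_
  · refine IsClosed.inter (IsClosed.inter (IsClosed.inter ?_ ?_) ?_) ?_
    · exact isClosed_antitone.preimage
        (f := fun (γ : Fin (m + 1) → ℝ) (i : Fin m) => γ i.castSucc) (continuous_pi fun i => continuous_apply _)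
    · change IsClosed {γ : Fin (m + 1) → ℝ | ∀ i : Fin m, 0 ≤ γ i.castSucc}
      simp only [Set.ofPred_forall]
      exact isClosed_iInter fun i => isClosed_le continuous_const (continuous_apply _)
    · change IsClosed {γ : Fin (m + 1) → ℝ | ∀ i : Fin m, |γ (Fin.last m)| ≤ γ i.castSucc}
      simp only [Set.ofPred_forall]
      exact isClosed_iInter fun i => isClosed_le (continuous_apply _).abs (continuous_apply _)
    · exact isClosed_eq (continuous_apply _) continuous_const
  · rintro γ ⟨⟨h1, h2⟩, h3⟩
    have h3 : γ 0 = 1 := h3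
    have h4 : ∀ i, |γ i| ≤ 1 := by
      intro i
      induction i using Fin.lastCases with
      | last =>
        rcases Nat.eq_zero_or_pos m with rfl | hm
        · rw [show Fin.last 0 = 0 from rfl, h3, abs_one]
        · rw [← h3]; exact h2 ⟨0, hm⟩
      | cast i =>
        rw [abs_of_nonneg (h1.2 i), ← h3]
        exact h1.1 (show (⟨0, i.pos⟩ : Fin m) ≤ i from Nat.zero_le _)
    exact ⟨fun i => (abs_le.1 (h4 i)).1, fun i => (abs_le.1 (h4 i)).2⟩

/-- The set is the projection of a closed set of pairs along the compact slice `γ 0 = 1` of the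
chamber. Closedness makes the hull events measurable. -/
theorem isClosed_zero_mem_hull (hm : 1 ≤ m) (h : 0 < m + 1) :
    IsClosed {y : Fin (m + 1) → EuclideanSpace ℝ (Fin d) |
      (0 : EuclideanSpace ℝ (Fin d)) ∈ hull h y} := by
  set K := chamberD m ∩ {γ : Fin (m + 1) → ℝ | γ 0 = 1}
  have : CompactSpace K := isCompact_iff_compactSpace.1 isCompact_chamberD_inter
  have hc : IsClosed {q : K × (Fin (m + 1) → EuclideanSpace ℝ (Fin d)) |
      ∑ i, q.1.1 i • q.2 i = 0} := by
    refine isClosed_eq ?_ continuous_const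
    exact continuous_finsetSum _ fun i _ =>
      (((continuous_apply i).comp continuous_subtype_val).comp continuous_fst).smul
        ((continuous_apply i).comp continuous_snd)
  convert isClosedMap_snd_of_compactSpace _ hc using 1
  ext y
  simp only [Set.mem_ofPred_eq, zero_mem_hull_iff hm h, Set.mem_image]
  constructor
  · rintro ⟨γ, h1, h2, h3⟩
    exact ⟨(⟨γ, h1, h2⟩, y), h3, rfl⟩
  · rintro ⟨⟨⟨γ, h1, h2⟩, _⟩, h3, rfl⟩
    exact ⟨γ, h1, h2, h3⟩

theorem continuous_partialSum {n : ℕ} (k : ℕ) :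
    Continuous fun y : Fin n → EuclideanSpace ℝ (Fin d) => partialSum y k :=
  continuous_finsetSum _ fun i _ => continuous_apply i

theorem continuous_flipLast :
    Continuous (flipLast : (Fin (m + 1) → EuclideanSpace ℝ (Fin d)) → _) :=
  continuous_id.update _ (continuous_apply _).neg

theorem continuous_signedPerm {n : ℕ} (σ : Equiv.Perm (Fin n)) (ε : Fin n → ℤˣ) :
    Continuous (signedPerm σ ε : (Fin n → EuclideanSpace ℝ (Fin d)) → _) :=
  continuous_pi fun i => (continuous_apply (σ i)).const_smul (sg (ε i))

theorem measurableSet_linearIndependent {n : ℕ} (I : Finset ℕ) :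
    MeasurableSet {y : Fin n → EuclideanSpace ℝ (Fin d) |
      LinearIndependent ℝ (fun k : I => partialSum y k)} := by
  have h : Continuous fun (y : Fin n → EuclideanSpace ℝ (Fin d)) (k : I) => partialSum y k :=
    continuous_pi fun k => continuous_partialSum (k : ℕ)
  exact (isOpen_setOfPred_linearIndependent.preimage h).measurableSet

theorem prod_sg {n : ℕ} (ε : Fin n → ℤˣ) : ∏ i, sg (ε i) = sg (∏ i, ε i) := by
  simp [sg, Units.coe_prod]

theorem exists_eq_flipLast_signedPerm {V : Type*} [AddCommGroup V] [Module ℝ V]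
    (ε : Fin (m + 1) → ℤˣ) (hε : ∏ i, ε i = -1) :
    ∃ ε' : Fin (m + 1) → ℤˣ, ∏ i, ε' i = 1 ∧ ∀ (σ : Equiv.Perm (Fin (m + 1)))
      (x : Fin (m + 1) → V), signedPerm σ ε x = flipLast (signedPerm σ ε' x) := by
  refine ⟨fun i => if i = Fin.last m then -ε i else ε i, ?_, fun σ x => ?_⟩
  · rw [Fin.prod_univ_castSucc] at *
    simp only [(Fin.castSucc_lt_last _).ne, if_false, if_true, mul_neg, hε, neg_neg]
  · ext i
    by_cases hi : i = Fin.last m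
    · subst hi; simp [signedPerm, flipLast]
    · simp [signedPerm, flipLast, hi]

variable {Ω : Type*} [MeasurableSpace Ω] {P : Measure Ω} {n : ℕ}

theorem IsDnInvariant.identDistrib {ξ : Fin n → Ω → EuclideanSpace ℝ (Fin d)}
    (hinv : IsDnInvariant ξ P) (σ : Equiv.Perm (Fin n)) (ε : Fin n → ℤˣ) (hε : ∏ i, ε i = 1) :
    IdentDistrib (fun ω i => ξ i ω) (fun ω => signedPerm σ ε fun i => ξ i ω) P P :=
  hinv σ (fun i => sg (ε i)) (fun i => sg_eq _) (by rw [prod_sg, hε, sg_one])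

theorem ae_generic {ξ : Fin (m + 1) → Ω → EuclideanSpace ℝ (Fin d)} (hd : d ≤ m + 1)
    (h : 0 < m + 1) (hinv : IsDnInvariant ξ P)
    (hgp : InGeneralPosition (m + 1) (fun k ω => partialSum (fun i => ξ i ω) k) P)
    (hgp' : InGeneralPosition (m + 1) (fun k ω => starWalk h (fun i => ξ i ω) k) P) :
    ∀ᵐ ω ∂P, Generic (fun i => ξ i ω) d := by
  have key : ∀ σ ε, ∀ I : Finset ℕ, ∀ᵐ ω ∂P, I ⊆ Finset.Icc 1 (m + 1) → I.card = d →
      LinearIndependent ℝ (fun k : I => partialSum (signedPerm σ ε fun i => ξ i ω) k) := by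
    intro σ ε I
    by_cases hI : I ⊆ Finset.Icc 1 (m + 1) ∧ I.card = d
    swap
    · exact Filter.Eventually.of_forall fun ω h1 h2 => absurd ⟨h1, h2⟩ hI
    have hI' : ∀ k : I, (k : ℕ) ≤ m + 1 := fun k => (Finset.mem_Icc.1 (hI.1 k.2)).2
    rcases Int.units_eq_one_or (∏ i, ε i) with hε | hε
    · have := (hinv.identDistrib σ ε hε).ae_snd (measurableSet_linearIndependent I)
        (hgp I hI.1 hI.2)
      filter_upwards [this] with ω hω _ _ using hω
    -- An odd sign pattern is an even one followed by negation of the last step, so general position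
    -- of the starred walk applies.
    · obtain ⟨ε', hε', hflip⟩ := exists_eq_flipLast_signedPerm
        (V := EuclideanSpace ℝ (Fin d)) ε hε
      have h1 := hgp' I hI.1 hI.2
      simp only [fun (k : I) (ω : Ω) => starWalk_eq h (fun i => ξ i ω) (hI' k)] at h1
      have := (hinv.identDistrib σ ε' hε').ae_snd
        (p := fun y => LinearIndependent ℝ (fun k : I => partialSum (flipLast y) k))
        (continuous_flipLast.measurable (measurableSet_linearIndependent I)) h1
      filter_upwards [this] with ω hω _ _
      rw [hflip]
      exact hω
  simp only [← ae_all_iff] at key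
  filter_upwards [key] with ω hω
  exact generic_of_linearIndependent hd hω

theorem measureReal_zero_mem_hull_signedPerm {ξ : Fin (m + 1) → Ω → EuclideanSpace ℝ (Fin d)}
    (hm : 1 ≤ m) (h : 0 < m + 1) (hinv : IsDnInvariant ξ P) (σ : Equiv.Perm (Fin (m + 1)))
    (ε : Fin (m + 1) → ℤˣ) :
    P.real {ω | (0 : EuclideanSpace ℝ (Fin d)) ∈ hull h (signedPerm σ ε fun i => ξ i ω)} =
      P.real {ω | (0 : EuclideanSpace ℝ (Fin d)) ∈ hull h fun i => ξ i ω} := by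
  have key : ∀ ε : Fin (m + 1) → ℤˣ, ∏ i, ε i = 1 →
      P.real {ω | (0 : EuclideanSpace ℝ (Fin d)) ∈ hull h (signedPerm σ ε fun i => ξ i ω)} =
      P.real {ω | (0 : EuclideanSpace ℝ (Fin d)) ∈ hull h fun i => ξ i ω} := fun ε hε =>
    congrArg ENNReal.toReal ((hinv.identDistrib σ ε hε).measure_mem_eq
      (isClosed_zero_mem_hull hm h).measurableSet).symm
  rcases Int.units_eq_one_or (∏ i, ε i) with hε | hε
  · exact key ε hε
  · obtain ⟨ε', hε', hflip⟩ := exists_eq_flipLast_signedPerm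
      (V := EuclideanSpace ℝ (Fin d)) ε hε
    simp only [hflip, hull_flipLast]
    exact key ε' hε'

theorem measureReal_zero_mem_hull [IsProbabilityMeasure P]
    {ξ : Fin (m + 1) → Ω → EuclideanSpace ℝ (Fin d)} {M : ℕ} (hM : m + 1 ≤ M)
    (hm : 1 ≤ m) (h : 0 < m + 1) (hξ : ∀ i, Measurable (ξ i)) (hinv : IsDnInvariant ξ P)
    (hgen : ∀ᵐ ω ∂P, Generic (fun i => ξ i ω) d) :
    P.real {ω | (0 : EuclideanSpace ℝ (Fin d)) ∈ hull h fun i => ξ i ω} =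
      2 / (2 ^ m * ((m + 1)! : ℝ)) * ∑ j ∈ Finset.range M, coeffD (m + 1) (d + 1 + 2 * j) := by
  have hX : Measurable fun ω i => ξ i ω := measurable_pi_lambda _ hξ
  let A : Equiv.Perm (Fin (m + 1)) → (Fin (m + 1) → ℤˣ) → Set Ω := fun σ ε =>
    {ω | (0 : EuclideanSpace ℝ (Fin d)) ∈ hull h (signedPerm σ ε fun i => ξ i ω)}
  have hA : ∀ σ ε, MeasurableSet (A σ ε) := fun σ ε =>
    ((continuous_signedPerm σ ε).measurable.comp hX) (isClosed_zero_mem_hull hm h).measurableSet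
  have hint : ∀ σ ε, Integrable ((A σ ε).indicator (1 : Ω → ℝ)) P := fun σ ε =>
    (integrable_const (1 : ℝ)).indicator (hA σ ε)
  have hind : ∀ σ ε ω, (A σ ε).indicator (1 : Ω → ℝ) ω =
      meet (relations fun i => ξ i ω) {β | act σ ε β ∈ chamberD m} := fun σ ε ω => by
    classical
    rw [Set.indicator_apply]
    exact if_congr (zero_mem_hull_signedPerm_iff hm h σ ε _) rfl rfl
  have h1 : ∑ σ, ∑ ε, P.real (A σ ε) =
      ∫ ω, ∑ σ, ∑ ε, (A σ ε).indicator (1 : Ω → ℝ) ω ∂P := by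
    rw [integral_finsetSum _ fun σ _ => integrable_finsetSum _ fun ε _ => hint σ ε]
    refine Finset.sum_congr rfl fun σ _ => ?_
    rw [integral_finsetSum _ fun ε _ => hint σ ε]
    exact Finset.sum_congr rfl fun ε _ => (integral_indicator_one (hA σ ε)).symm
  have h2 : (fun ω => ∑ σ, ∑ ε, (A σ ε).indicator (1 : Ω → ℝ) ω) =ᵐ[P] fun _ =>
      4 * ∑ j ∈ Finset.range M, coeffD (m + 1) (d + 1 + 2 * j) := by
    filter_upwards [hgen] with ω hω
    simp only [hind]
    exact sum_meet_chamberD_eq hm _ hM (by simp) hω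
  rw [integral_congr_ae h2, integral_const, probReal_univ, one_smul] at h1
  -- All summands coincide, so `2^(m+1) (m+1)!` times the probability equals the constant count.
  simp only [A, measureReal_zero_mem_hull_signedPerm hm h hinv, Finset.sum_const,
    Finset.card_univ, Fintype.card_perm, Fintype.card_fin, Fintype.card_pi,
    Fintype.card_units_int, Finset.prod_const, nsmul_eq_mul] at h1
  push_cast at h1
  rw [div_mul_eq_mul_div, eq_div_iff (by positivity)]
  rw [pow_succ] at h1
  linarith

end

end DnWalk

end

/-- The sum over `j` is the series `D(n, d+1) + D(n, d+3) + ...`; the terms left out vanish, since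
`D(n, k) = 0` for `k > n`. -/
theorem theorem2p6 {Ω : Type*} [MeasurableSpace Ω] (P : Measure Ω) [IsProbabilityMeasure P]
    (n d : ℕ) (hn : 2 ≤ n) (hd : d ≤ n)
    (ξ : Fin n → Ω → EuclideanSpace ℝ (Fin d)) (hξ : ∀ i, Measurable (ξ i))
    (hinv : DnWalk.IsDnInvariant ξ P)
    (hgp : DnWalk.InGeneralPosition n (fun k ω => DnWalk.partialSum (fun i => ξ i ω) k) P)
    (hgp' : DnWalk.InGeneralPosition n
      (fun k ω => DnWalk.starWalk (Nat.zero_lt_of_lt hn) (fun i => ξ i ω) k) P) :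
    P.real {ω | (0 : EuclideanSpace ℝ (Fin d)) ∈
        DnWalk.hull (Nat.zero_lt_of_lt hn) (fun i => ξ i ω)} =
      2 / (2 ^ (n - 1) * (n ! : ℝ)) *
        ∑ j ∈ Finset.range (n + 1), DnWalk.coeffD n (d + 1 + 2 * j) := by
  obtain ⟨m, rfl⟩ : ∃ m, n = m + 1 := ⟨n - 1, by omega⟩
  exact DnWalk.measureReal_zero_mem_hull (Nat.le_succ _) (Nat.le_of_succ_le_succ hn) _ hξ hinv
    (DnWalk.ae_generic hd _ hinv hgp hgp')
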